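/- Let $L=L_1\oplus\dots\oplus L_n$ be a finite direct sum of fields, with unit elements $e_i\in L_i$. For an $L$-bimodule $P$ put $P_{ij}=e_iPe_j$, so that $P=\oplus_{i,j}P_{ij}$. Let $\Gamma(P)$ be the oriented graph with vertices $1,\dots,n$ and an edge $i\to j$ whenever $P_{ji}\neq 0$; $P$ is called connected if $\Gamma(P)$ is connected as a graph, orientation being ignored (in particular $n\ge 1$). For ${\bf p}=(p_1,\dots,p_n)$ put $L^{\bf p}=L_1^{p_1}\oplus\dots\oplus L_n^{p_n}$. $P$ is called quasi-Galois of rank $d$ and type $({\bf p},{\bf q})$ if $P\cong L^{\bf p}$ as a left $L$-module, $P\cong L^{\bf q}$ as a right $L$-module, and $P\otimes_LP\cong P^d$ as an $L$-bimodule. $P$ is called Galois of rank $d\ge1$ if $P\cong L^d$ as a left $L$-module and as a right $L$-module, and $P\otimes_LP\cong P^d$ as an $L$-bimodule. The center of $P$ is ${\mathcal Z}=\{z\in L: zx=xz \text{ for all } x\in P\}$. Let $P$ be a connected quasi-Galois $L$-bimodule of some rank $d$ and some type $({\bf p},{\bf q})$ in which all the numbers $p_i$ and $q_i$ are positive (equivalently,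 $e_iP\ne0$ and $Pe_i\neq0$ for every $i$). Then: (1) ${\mathcal Z}$ is a field, and for each $i$ the projection $L\to L_i$ restricts to an embedding $\psi_i:{\mathcal Z}\to L_i$ with $[L_i:\psi_i({\mathcal Z})]<\infty$. (2) There are positive integers $a_1,\dots,a_n$ and $r_1,\dots,r_n$ such that $P\cong\bigoplus_{i,j}(L_i\otimes_{\mathcal Z}L_j)^{a_ir_j}$ as $L$-bimodules, where $L_i$ is a ${\mathcal Z}$-algebra through $\psi_i$, and $L$ acts on the summand of index $(i,j)$ from the left through $L_i$ and from the right through $L_j$. (3) If moreover $P$ is Galois, then $P\cong(L\otimes_{\mathcal Z}L)^m$ as $L$-bimodules for some positive integer $m$. -/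

import Mathlib

open MulOpposite
open scoped TensorProduct

universe u v w

set_option linter.unusedSectionVars false

/-! An `A`-bimodule is, as in Mathlib, an additive group with commuting actions of `A` (from the
left) and of `Aᵐᵒᵖ` (from the right): `op a • x` is `x a`. -/

section Bimodules

variable (A : Type u) [Ring A]

/-- `P` and `Q` are isomorphic as `A`-bimodules. -/
def BimoduleIso (P : Type v) (Q : Type w) [AddCommGroup P] [Module A P] [Module Aᵐᵒᵖ P]
    [AddCommGroup Q] [Module A Q] [Module Aᵐᵒᵖ Q] : Prop :=
  ∃ e : P ≃ₗ[A] Q, ∀ (a : A) (x : P), e (op a • x) = op a • e x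

/-- The center of an `A`-bimodule: all `z` in `A` with `z x = x z` for every `x` in `P`. -/
def bimoduleCenter (P : Type v) [AddCommGroup P] [Module A P] [Module Aᵐᵒᵖ P]
    [SMulCommClass A Aᵐᵒᵖ P] : Subring A where
  carrier := {z | ∀ x : P, z • x = op z • x}
  mul_mem' := by
    intro a b ha hb x
    rw [mul_smul, hb x, smul_comm, ha x, ← mul_smul, op_mul]
  one_mem' := by intro x; simp
  add_mem' := by
    intro a b ha hb x
    rw [add_smul, ha x, hb x, op_add, add_smul]
  zero_mem' := by intro x; simp
  neg_mem' := by
    intro a ha x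
    rw [neg_smul, ha x, op_neg, neg_smul]

variable (P : Type v) [AddCommGroup P] [Module A P] [Module Aᵐᵒᵖ P] [SMulCommClass A Aᵐᵒᵖ P]
variable (Q : Type w) [AddCommGroup Q] [Module A Q] [Module Aᵐᵒᵖ Q] [SMulCommClass A Aᵐᵒᵖ Q]

/-- The relations `x a ⊗ y = x ⊗ a y`. -/
def BimoduleTensor.relations : AddSubgroup (P ⊗[ℤ] Q) :=
  AddSubgroup.closure
    {t | ∃ (x : P) (a : A) (y : Q), t = (op a • x) ⊗ₜ[ℤ] y - x ⊗ₜ[ℤ] (a • y)}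

/-- The tensor product `P ⊗_A Q` of `A`-bimodules. -/
def BimoduleTensor : Type (max v w) := (P ⊗[ℤ] Q) ⧸ BimoduleTensor.relations A P Q

namespace BimoduleTensor

instance : AddCommGroup (BimoduleTensor A P Q) :=
  inferInstanceAs (AddCommGroup ((P ⊗[ℤ] Q) ⧸ BimoduleTensor.relations A P Q))

variable {P Q} in
/-- The pure tensor `x ⊗ y`. -/
def tmul (x : P) (y : Q) : BimoduleTensor A P Q :=
  QuotientAddGroup.mk' (relations A P Q) (x ⊗ₜ[ℤ] y)

variable {A P Q} in
theorem addHom_ext {f g : AddMonoid.End (BimoduleTensor A P Q)}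
    (h : ∀ (x : P) (y : Q), f (tmul A x y) = g (tmul A x y)) : f = g := by
  refine QuotientAddGroup.addMonoidHom_ext (relations A P Q) (AddMonoidHom.ext fun t => ?_)
  induction t using TensorProduct.induction_on with
  | zero => rw [map_zero, map_zero]
  | tmul x y => exact h x y
  | add s t hs ht => rw [map_add, map_add, hs, ht]

/-- The left action `a (x ⊗ y) = a x ⊗ y`. -/
def leftEnd (a : A) : AddMonoid.End (BimoduleTensor A P Q) :=
  QuotientAddGroup.map (relations A P Q) (relations A P Q)
    (TensorProduct.map (DistribSMul.toAddMonoidHom P a).toIntLinearMap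
      (LinearMap.id (M := Q))).toAddMonoidHom
    ((AddSubgroup.closure_le _).2 (by
      rintro _ ⟨x, b, y, rfl⟩
      refine AddSubgroup.subset_closure ⟨a • x, b, y, ?_⟩
      rw [← smul_comm a (op b) x, map_sub]
      rfl))

/-- The right action `(x ⊗ y) a = x ⊗ y a`. -/
def rightEnd (a : Aᵐᵒᵖ) : AddMonoid.End (BimoduleTensor A P Q) :=
  QuotientAddGroup.map (relations A P Q) (relations A P Q)
    (TensorProduct.map (LinearMap.id (M := P))
      (DistribSMul.toAddMonoidHom Q a).toIntLinearMap).toAddMonoidHom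
    ((AddSubgroup.closure_le _).2 (by
      rintro _ ⟨x, b, y, rfl⟩
      refine AddSubgroup.subset_closure ⟨x, b, a • y, ?_⟩
      rw [smul_comm b a y, map_sub]
      rfl))

theorem leftEnd_tmul (a : A) (x : P) (y : Q) :
    leftEnd A P Q a (tmul A x y) = tmul A (a • x) y := rfl

theorem rightEnd_tmul (a : Aᵐᵒᵖ) (x : P) (y : Q) :
    rightEnd A P Q a (tmul A x y) = tmul A x (a • y) := rfl

theorem add_tmul (x x' : P) (y : Q) : tmul A (x + x') y = tmul A x y + tmul A x' y := by
  simp only [tmul, TensorProduct.add_tmul, map_add]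
  rfl

theorem tmul_add (x : P) (y y' : Q) : tmul A x (y + y') = tmul A x y + tmul A x y' := by
  simp only [tmul, TensorProduct.tmul_add, map_add]
  rfl

theorem zero_tmul (y : Q) : tmul A (0 : P) y = 0 := by
  simp only [tmul, TensorProduct.zero_tmul, map_zero]
  rfl

theorem tmul_zero (x : P) : tmul A x (0 : Q) = 0 := by
  simp only [tmul, TensorProduct.tmul_zero, map_zero]
  rfl

instance : Module A (BimoduleTensor A P Q) :=
  Module.compHom (BimoduleTensor A P Q)
    ({ toFun := leftEnd A P Q
       map_one' := addHom_ext fun x y => by rw [leftEnd_tmul, one_smul]; rfl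
       map_mul' := fun a b => addHom_ext fun x y => by rw [leftEnd_tmul, mul_smul]; rfl
       map_zero' := addHom_ext fun x y => by rw [leftEnd_tmul, zero_smul, zero_tmul]; rfl
       map_add' := fun a b => addHom_ext fun x y => by
        rw [leftEnd_tmul, add_smul, add_tmul]; rfl } :
      A →+* AddMonoid.End (BimoduleTensor A P Q))

instance : Module Aᵐᵒᵖ (BimoduleTensor A P Q) :=
  Module.compHom (BimoduleTensor A P Q)
    ({ toFun := rightEnd A P Q
       map_one' := addHom_ext fun x y => by rw [rightEnd_tmul, one_smul]; rfl
       map_mul' := fun a b => addHom_ext fun x y => by rw [rightEnd_tmul, mul_smul]; rfl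
       map_zero' := addHom_ext fun x y => by rw [rightEnd_tmul, zero_smul, tmul_zero]; rfl
       map_add' := fun a b => addHom_ext fun x y => by
        rw [rightEnd_tmul, add_smul, tmul_add]; rfl } :
      Aᵐᵒᵖ →+* AddMonoid.End (BimoduleTensor A P Q))

instance : SMulCommClass A Aᵐᵒᵖ (BimoduleTensor A P Q) where
  smul_comm a b t := by
    have h : leftEnd A P Q a * rightEnd A P Q b = rightEnd A P Q b * leftEnd A P Q a :=
      addHom_ext fun x y => rfl
    exact DFunLike.congr_fun h t

end BimoduleTensor

/-- A Galois `A`-bimodule of rank `d`. -/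
def IsGaloisBimodule (d : ℕ) : Prop :=
  1 ≤ d ∧ Nonempty (P ≃ₗ[A] (Fin d → A)) ∧ Nonempty (P ≃ₗ[Aᵐᵒᵖ] (Fin d → A)) ∧
    BimoduleIso A (BimoduleTensor A P P) (Fin d → P)

end Bimodules

section TwoSided

/-- A commutative ring `R` regarded as a bimodule over a commutative ring `A`, on which `A` acts
from the left through `f` and from the right through `g`. -/
def TwoSided {A : Type u} {R : Type v} [CommRing A] [CommRing R] (_f _g : A →+* R) : Type v := R

variable {A : Type u} {R : Type v} [CommRing A] [CommRing R] (f g : A →+* R)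

instance : AddCommGroup (TwoSided f g) := inferInstanceAs (AddCommGroup R)

instance : Module A (TwoSided f g) :=
  Module.compHom R f

instance : Module Aᵐᵒᵖ (TwoSided f g) :=
  Module.compHom R (g.comp (RingEquiv.toOpposite A).symm.toRingHom)

end TwoSided

section CommutativeSemisimple

variable {ι : Type u} (K : ι → Type v) [∀ i, Field (K i)]

section Graph

variable [DecidableEq ι] (P : Type w) [AddCommGroup P] [Module (∀ i, K i) P]
  [Module (∀ i, K i)ᵐᵒᵖ P]

/-- The component `P_ij = e_i P e_j`, where `e_i` is the unit of the factor `L_i` of `L = ∏ L_i`. -/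
def bimoduleComponent (i j : ι) : Set P :=
  {y | ∃ x : P, y = (Pi.single i 1 : ∀ i, K i) • (op (Pi.single j 1 : ∀ i, K i) • x)}

/-- The oriented incidence graph: there is an edge from `i` to `j` if `P_ji ≠ 0`. -/
def incidenceEdge (i j : ι) : Prop := ∃ y ∈ bimoduleComponent K P j i, y ≠ 0

/-- `P` is connected: its incidence graph is a connected graph (orientation being ignored). -/
def IsConnectedBimodule : Prop := (SimpleGraph.fromRel (incidenceEdge K P)).Connected

end Graph

/-- `P` is a quasi-Galois bimodule over `L = ∏ L_i` of rank `d` and type `(p, q)`: it is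
isomorphic to `∏ L_i ^ (p i)` as a left module, to `∏ L_i ^ (q i)` as a right module, and
`P ⊗_L P ≅ P ^ d` as a bimodule. -/
def IsQuasiGaloisBimodule (P : Type w) [AddCommGroup P] [Module (∀ i, K i) P]
    [Module (∀ i, K i)ᵐᵒᵖ P] [SMulCommClass (∀ i, K i) (∀ i, K i)ᵐᵒᵖ P]
    (d : ℕ) (p q : ι → ℕ) : Prop :=
  (∃ e : P ≃+ (∀ i, Fin (p i) → K i),
      ∀ (l : ∀ i, K i) (x : P) (i : ι) (k : Fin (p i)), e (l • x) i k = l i * e x i k) ∧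
    (∃ e : P ≃+ (∀ i, Fin (q i) → K i),
      ∀ (l : ∀ i, K i) (x : P) (i : ι) (k : Fin (q i)), e (op l • x) i k = e x i k * l i) ∧
    BimoduleIso (∀ i, K i) (BimoduleTensor (∀ i, K i) P P) (Fin d → P)

variable {K}
variable (Z : Subring (∀ i, K i))

/-- The coordinate map `ψ_i : Z → L_i` of a subring `Z` of `∏ L_i`. -/
def coordHom (i : ι) : Z →+* K i := (Pi.evalRingHom K i).comp Z.subtype

/-- `L_i` as a `Z`-algebra through `ψ_i`. -/
@[reducible]
def coordAlgebra (i : ι) : Algebra Z (K i) := (coordHom Z i).toAlgebra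

attribute [local instance] coordAlgebra

/-- The direct sum over `i, j` of `(L_i ⊗_Z L_j) ^ (a i * r j)`, as a ring. -/
abbrev BlockRing (a r : ι → ℕ) : Type (max u v) :=
  ∀ i j : ι, Fin (a i * r j) → (K i ⊗[Z] K j)

/-- The `L`-bimodule `⊕_{i,j} (L_i ⊗_Z L_j) ^ (a i * r j)`: an element `l` of `L = ∏ L_i` acts on
the summand of index `(i, j)` as `l i ⊗ 1` from the left and as `1 ⊗ l j` from the right. -/
abbrev BlockBimodule (a r : ι → ℕ) : Type (max u v) :=
  TwoSided (A := ∀ i, K i) (R := BlockRing Z a r)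
    (RingHom.pi fun i => RingHom.pi fun j => RingHom.pi fun _ =>
      (Algebra.TensorProduct.includeLeftRingHom (R := Z) (A := K i) (B := K j)).comp
        (Pi.evalRingHom K i))
    (RingHom.pi fun i => RingHom.pi fun j => RingHom.pi fun _ =>
      (Algebra.TensorProduct.includeRight (R := Z) (A := K i) (B := K j)).toRingHom.comp
        (Pi.evalRingHom K j))

end CommutativeSemisimple

/-- The `L`-bimodule `L ⊗_Z L` for a subring `Z` of a commutative ring `L`. -/
abbrev TensorSquareBimodule {L : Type u} [CommRing L] (Z : Subring L) : Type u :=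
  TwoSided (A := L) (R := L ⊗[Z] L)
    (Algebra.TensorProduct.includeLeftRingHom (R := Z) (A := L) (B := L))
    (Algebra.TensorProduct.includeRight (R := Z) (A := L) (B := L)).toRingHom

/-! Write `C i j` for `e_i P e_j` and `p i j` for its dimension over `K i`. The isomorphism `P ⊗ P ≅
P ^ d` splits into isomorphisms `⨁ j, C i j ⊗ C j k ≅ (C i k) ^ d`, whose consequences are collected
in `IsTensorPower`. In particular `p² = d p`. Since `p` has no zero row or column, its support is an
equivalence relation, and connectedness makes every `C i j` nonzero.

The heart is an independence argument in the style of Dedekind and Artin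
(`IsTensorPower.eq_zero_of_sum_smul_eq_zero`): elements of `K j` independent over the center `Z` act
on `C i j` from the right as operators independent over `K i`. A shortest relation can be
transported from one index to another, and its uniqueness up to scaling makes its coefficients
central. Hence `K j` is finite over `Z`.

Next, `C i j` is free over the artinian ring `K i ⊗[Z] K j`. Let `g i j` be its minimal number of
generators, which is the largest of its local dimensions. A `K i`-basis of `C i j` times generators
of `C j k`, over all `j`, generates `(C i k) ^ d`, so `d g ≤ p g` entrywise; pairing with the column
sums of `p`, a positive left eigenvector, forces equality. These products are therefore a minimal
generating set at a maximal ideal `α`, and every relation between them has coefficients in `α`.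
Multiplying a relation between generators of `C j k` by elements of `C i j` produces such relations;
a socle element for `α` kills their coefficients, and `IsTensorPower.eq_zero_of_mul_rTensor_eq_zero`
concludes that the original relation is trivial.

Freeness gives `p i j = [K j : Z] * g i j` and `p g = d g` with positive entries, so `g` has rank
one (`mul_eq_mul_of_forall_fixed`) and factors as `a i * r j` over the positive integers. In the
Galois case all left dimensions of rows and all right dimensions of columns agree, which makes `a`
and `r` constant. -/

/-! ### Minimal generating sets over artinian rings. -/

section Semilocal

variable {S : Type*} [CommRing S] {M : Type*} [AddCommGroup M] [Module S M]

/-- Nakayama at a maximal ideal `α` containing the annihilator of `M ⧸ N`: some `r ≡ 1` modulo `α`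
kills `M ⧸ N`, hence lies in `α`, which is absurd. -/
theorem Submodule.eq_top_of_forall_isMaximal_sup_smul_eq_top [Module.Finite S M]
    (N : Submodule S M)
    (h : ∀ α : Ideal S, α.IsMaximal → N ⊔ α • (⊤ : Submodule S M) = ⊤) : N = ⊤ := by
  have hann : Module.annihilator S (M ⧸ N) = ⊤ := by
    by_contra hne
    obtain ⟨α, hα, hle⟩ := Ideal.exists_le_maximal _ hne
    have hQ : (⊤ : Submodule S (M ⧸ N)) ≤ α • ⊤ := by
      have := congrArg (Submodule.map N.mkQ) (h α hα)
      rw [Submodule.map_sup, Submodule.map_smul'', Submodule.map_top, Submodule.range_mkQ,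
        Submodule.mkQ_map_self, bot_sup_eq] at this
      exact this.ge
    obtain ⟨r, hr, h0⟩ := Submodule.exists_sub_one_mem_and_smul_eq_zero_of_fg_of_le_smul α ⊤
      Module.Finite.fg_top hQ
    have hrα : r ∈ α := hle (Module.mem_annihilator.2 fun x => h0 x trivial)
    refine hα.ne_top ((Ideal.eq_top_iff_one _).2 ?_)
    simpa using sub_mem hrα hr
  rw [Module.annihilator_eq_top_iff, Submodule.Quotient.subsingleton_iff] at hann
  exact hann

theorem Module.exists_fin_span_range_eq_top {k V : Type*} [Field k] [AddCommGroup V] [Module k V]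
    [Module.Finite k V] {n : ℕ} (h : Module.finrank k V ≤ n) :
    ∃ x : Fin n → V, Submodule.span k (Set.range x) = ⊤ := by
  let b := Module.finBasis k V
  -- A basis, padded with zeros up to length `n`.
  refine ⟨fun i => if hi : (i : ℕ) < Module.finrank k V then b ⟨i, hi⟩ else 0, ?_⟩
  rw [eq_top_iff, ← b.span_eq]
  refine Submodule.span_mono ?_
  rintro _ ⟨i, rfl⟩
  exact ⟨⟨i, i.2.trans_le h⟩, by simp⟩

theorem Submodule.span_range_sup_smul_top_eq_top_iff (α : Ideal S) {κ : Type*} (x : κ → M) :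
    Submodule.span S (Set.range x) ⊔ α • (⊤ : Submodule S M) = ⊤ ↔
      Submodule.span (S ⧸ α) (Set.range fun k => (α • (⊤ : Submodule S M)).mkQ (x k)) = ⊤ := by
  rw [← Submodule.restrictScalars_eq_top_iff S (S ⧸ α),
    Submodule.restrictScalars_span S (S ⧸ α) Ideal.Quotient.mk_surjective,
    show (Set.range fun k => (α • (⊤ : Submodule S M)).mkQ (x k)) =
      (α • (⊤ : Submodule S M)).mkQ '' Set.range x from Set.range_comp _ _,
    ← Submodule.map_span]
  constructor
  · intro h
    have := congrArg (Submodule.map (α • (⊤ : Submodule S M)).mkQ) h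
    rwa [Submodule.map_sup, Submodule.mkQ_map_self, sup_bot_eq, Submodule.map_top,
      Submodule.range_mkQ] at this
  · intro h
    have := congrArg (Submodule.comap (α • (⊤ : Submodule S M)).mkQ) h
    rwa [Submodule.comap_map_mkQ, Submodule.comap_top, sup_comm] at this

theorem Submodule.exists_fin_span_range_sup_smul_top_eq_top (α : Ideal S) [α.IsMaximal] [Module.Finite S M] {n : ℕ}
    (h : Module.finrank (S ⧸ α) (M ⧸ α • (⊤ : Submodule S M)) ≤ n) :
    ∃ x : Fin n → M, Submodule.span S (Set.range x) ⊔ α • (⊤ : Submodule S M) = ⊤ := by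
  have : Module.Finite (S ⧸ α) (M ⧸ α • (⊤ : Submodule S M)) :=
    Module.Finite.of_restrictScalars_finite S _ _
  let := Ideal.Quotient.field α
  obtain ⟨y, hy⟩ := Module.exists_fin_span_range_eq_top (k := S ⧸ α) h
  choose x hx using fun i => Submodule.mkQ_surjective _ (y i)
  refine ⟨x, (Submodule.span_range_sup_smul_top_eq_top_iff α x).2 ?_⟩
  simp only [hx]
  exact hy

/-- Modulo `α` the generators span a space whose dimension is their number, so they form a basis
there. -/
theorem Module.mem_of_sum_smul_eq_zero_of_card_eq_finrank_quotient {κ : Type*} [Fintype κ]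
    (x : κ → M) (hx : Submodule.span S (Set.range x) = ⊤) (α : Ideal S) [α.IsMaximal]
    (hcard : Fintype.card κ = Module.finrank (S ⧸ α) (M ⧸ α • (⊤ : Submodule S M)))
    (τ : κ → S) (hτ : ∑ k, τ k • x k = 0) (k : κ) : τ k ∈ α := by
  have hspan := (Submodule.span_range_sup_smul_top_eq_top_iff α x).1 (by rw [hx, top_sup_eq])
  have hli := linearIndependent_of_top_le_span_of_card_eq_finrank hspan.ge hcard
  refine Ideal.Quotient.eq_zero_iff_mem.1
    (Fintype.linearIndependent_iff.1 hli (fun k => Ideal.Quotient.mk α (τ k)) ?_ k)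
  have := congrArg (α • (⊤ : Submodule S M)).mkQ hτ
  rw [map_sum, map_zero] at this
  rw [← this]
  exact Finset.sum_congr rfl fun k _ => rfl

theorem Module.finrank_quotient_le_card {κ : Type*} [Fintype κ]
    (x : κ → M) (hx : Submodule.span S (Set.range x) = ⊤) (α : Ideal S) [α.IsMaximal] :
    Module.finrank (S ⧸ α) (M ⧸ α • (⊤ : Submodule S M)) ≤ Fintype.card κ := by
  have hspan := (Submodule.span_range_sup_smul_top_eq_top_iff α x).1 (by rw [hx, top_sup_eq])
  have := finrank_range_le_card (R := S ⧸ α) fun k => (α • (⊤ : Submodule S M)).mkQ (x k)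
  rwa [Set.finrank, hspan, finrank_top] at this

theorem Module.finrank_pi_quotient_smul_top [Module.Finite S M] (α : Ideal S) [α.IsMaximal] (d : ℕ) :
    Module.finrank (S ⧸ α) ((Fin d → M) ⧸ α • (⊤ : Submodule S (Fin d → M))) =
      d * Module.finrank (S ⧸ α) (M ⧸ α • (⊤ : Submodule S M)) := by
  have hfin : Module.Finite (S ⧸ α) (M ⧸ α • (⊤ : Submodule S M)) :=
    Module.Finite.of_restrictScalars_finite S _ _
  let f : (Fin d → M) →ₗ[S] (Fin d → M ⧸ α • (⊤ : Submodule S M)) :=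
    LinearMap.pi fun i => (α • (⊤ : Submodule S M)).mkQ ∘ₗ LinearMap.proj i
  have hsurj : Function.Surjective f := by
    intro y
    choose x hx using fun i => Submodule.mkQ_surjective _ (y i)
    exact ⟨x, funext hx⟩
  have hker : LinearMap.ker f = α • (⊤ : Submodule S (Fin d → M)) := by
    refine le_antisymm (fun x hx => ?_) (Submodule.smul_le.2 fun a ha x _ => ?_)
    · have hx' : ∀ i, x i ∈ α • (⊤ : Submodule S M) := fun i => by
        have := congrFun (LinearMap.mem_ker.1 hx) i
        exact (Submodule.Quotient.mk_eq_zero _).1 this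
      have hsum : x = ∑ i, LinearMap.single S (fun _ : Fin d => M) i (x i) := by
        simp [LinearMap.single_apply, Finset.univ_sum_single]
      rw [hsum]
      refine Submodule.sum_mem _ fun i _ => ?_
      have := Submodule.mem_map_of_mem (f := LinearMap.single S (fun _ : Fin d => M) i) (hx' i)
      rw [Submodule.map_smul''] at this
      exact Submodule.smul_mono le_rfl le_top this
    · refine LinearMap.mem_ker.2 (funext fun i => ?_)
      exact (Submodule.Quotient.mk_eq_zero _).2 (Submodule.smul_mem_smul ha trivial)
  let e : ((Fin d → M) ⧸ α • (⊤ : Submodule S (Fin d → M))) ≃ₗ[S]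
      (Fin d → M ⧸ α • (⊤ : Submodule S M)) :=
    (Submodule.quotEquivOfEq _ _ hker.symm).trans (f.quotKerEquivOfSurjective hsurj)
  let e' : ((Fin d → M) ⧸ α • (⊤ : Submodule S (Fin d → M))) ≃ₗ[S ⧸ α]
      (Fin d → M ⧸ α • (⊤ : Submodule S M)) :=
    LinearEquiv.extendScalarsOfSurjective Ideal.Quotient.mk_surjective e
  let := Ideal.Quotient.field α
  rw [e'.finrank_eq]
  have := Module.finrank_pi_fintype (S ⧸ α) (M := fun _ : Fin d => M ⧸ α • (⊤ : Submodule S M))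
  rw [Finset.sum_const, Finset.card_univ, Fintype.card_fin, smul_eq_mul] at this
  exact this

/-- Primes of an artinian ring are maximal, so `α` is a minimal prime and hence an associated one:
`S ⧸ α` embeds in `S`, and `σ` is the image of `1`. -/
theorem IsArtinianRing.exists_ne_zero_forall_mem_mul_eq_zero [IsArtinianRing S] (α : Ideal S)
    [hα : α.IsMaximal] : ∃ σ : S, σ ≠ 0 ∧ ∀ a ∈ α, a * σ = 0 := by
  have hmin : α ∈ (Module.annihilator S S).minimalPrimes := by
    refine ⟨⟨hα.isPrime, ?_⟩, ?_⟩
    · rw [Module.annihilator_eq_bot.2 inferInstance]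
      exact bot_le
    · rintro β ⟨hβ, -⟩ hle
      have := IsArtinianRing.isMaximal_of_isPrime β
      exact (this.eq_of_le hα.ne_top hle).ge
  have := Module.associatedPrimes.minimalPrimes_annihilator_subset_associatedPrimes S S hmin
  obtain ⟨-, f, hf⟩ := (isAssociatedPrime_iff_exists_injective_linearMap _ _).1 this
  have : Nontrivial (S ⧸ α) := Ideal.Quotient.nontrivial_iff.2 hα.ne_top
  refine ⟨f 1, fun h => one_ne_zero (hf (h.trans (map_zero f).symm)), fun a ha => ?_⟩
  rw [← smul_eq_mul, ← map_smul, ← map_zero f]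
  congr 1
  rw [Algebra.smul_def, mul_one]
  exact Ideal.Quotient.eq_zero_iff_mem.2 ha

/-- The local generators are glued with the Chinese remainder theorem: `e α` is `1` modulo `α` and
`0` modulo the other maximal ideals. -/
theorem Module.exists_fin_span_range_eq_top_of_finite_maximalSpectrum [Finite (MaximalSpectrum S)]
    [Module.Finite S M] {n : ℕ} (x : MaximalSpectrum S → Fin n → M)
    (hx : ∀ α, Submodule.span S (Set.range (x α)) ⊔ α.asIdeal • (⊤ : Submodule S M) = ⊤) :
    ∃ y : Fin n → M, Submodule.span S (Set.range y) = ⊤ := by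
  classical
  have : Fintype (MaximalSpectrum S) := Fintype.ofFinite _
  have hcop : Pairwise (Function.onFun IsCoprime fun α : MaximalSpectrum S => α.asIdeal) := by
    intro α β hne
    exact Ideal.isCoprime_of_isMaximal fun h => hne (MaximalSpectrum.ext h)
  have hex : ∀ α : MaximalSpectrum S, ∃ e : S, ∀ β : MaximalSpectrum S,
      e - (if β = α then 1 else 0) ∈ β.asIdeal := fun α =>
    Ideal.exists_forall_sub_mem_ideal hcop fun β => if β = α then 1 else 0
  choose e he using hex
  refine ⟨fun r => ∑ α, e α • x α r, ?_⟩
  refine Submodule.eq_top_of_forall_isMaximal_sup_smul_eq_top _ fun α hα => ?_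
  refine top_le_iff.1 ((hx ⟨α, hα⟩).ge.trans ?_)
  refine sup_le (Submodule.span_le.2 ?_) le_sup_right
  rintro _ ⟨r, rfl⟩
  have hsplit : x ⟨α, hα⟩ r = (∑ β, e β • x β r) +
      ∑ β, ((if (⟨α, hα⟩ : MaximalSpectrum S) = β then 1 else 0) - e β) • x β r := by
    simp only [sub_smul, Finset.sum_sub_distrib, add_sub_cancel, ite_smul, one_smul, zero_smul,
      Finset.sum_ite_eq, Finset.mem_univ, if_true]
  rw [SetLike.mem_coe, hsplit]
  refine Submodule.add_mem_sup (Submodule.subset_span ⟨r, rfl⟩) (Submodule.sum_mem _ fun β _ => ?_)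
  refine Submodule.smul_mem_smul ?_ trivial
  rw [← neg_sub]
  exact neg_mem (he β ⟨α, hα⟩)

variable (S M) in
theorem Module.exists_span_range_eq_top_and_finrank_quotient_eq [IsArtinianRing S] [Nontrivial S]
    [Module.Finite S M] : ∃ (g : ℕ) (x : Fin g → M) (α : Ideal S), α.IsMaximal ∧
      Submodule.span S (Set.range x) = ⊤ ∧
      g = Module.finrank (S ⧸ α) (M ⧸ α • (⊤ : Submodule S M)) := by
  obtain ⟨α₀, hα₀⟩ := Finite.exists_max fun α : MaximalSpectrum S =>
    Module.finrank (S ⧸ α.asIdeal) (M ⧸ α.asIdeal • (⊤ : Submodule S M))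
  choose x hx using fun α : MaximalSpectrum S =>
    Submodule.exists_fin_span_range_sup_smul_top_eq_top (M := M) α.asIdeal (hα₀ α)
  obtain ⟨y, hy⟩ := Module.exists_fin_span_range_eq_top_of_finite_maximalSpectrum x hx
  exact ⟨_, y, α₀.asIdeal, α₀.isMaximal, hy, rfl⟩

end Semilocal

/-! ### Nonnegative integer matrices with `p² = d p`. -/

section NonnegativeMatrices

variable {ι : Type*} [Fintype ι]

/-- The weights `z a * p a b * y b`, with `z` the column sums and `y` the row sums, form a
circulation: inflow and outflow at `i` both equal `d * z i * y i`. The weighted total increase of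
`c` along edges is therefore zero, and a `c` that never decreases along an edge is constant along
it. -/
theorem mul_eq_mul_of_mul_le_mul_of_sq_eq_mul {p : ι → ι → ℕ} {d : ℕ}
    (hsq : ∀ i k, ∑ j, p i j * p j k = d * p i k)
    (hrow : ∀ i, ∃ j, 0 < p i j) (hcol : ∀ j, ∃ i, 0 < p i j) (c : ι → ℕ)
    (hc : ∀ a b, c a * p a b ≤ c b * p a b) (a b : ι) : c a * p a b = c b * p a b := by
  let y : ι → ℕ := fun i => ∑ j, p i j
  let z : ι → ℕ := fun j => ∑ i, p i j
  have hy : ∀ i, 0 < y i := fun i =>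
    let ⟨j, hj⟩ := hrow i
    hj.trans_le (Finset.single_le_sum (f := fun j => p i j) (fun _ _ => Nat.zero_le _)
      (Finset.mem_univ j))
  have hz : ∀ j, 0 < z j := fun j =>
    let ⟨i, hi⟩ := hcol j
    hi.trans_le (Finset.single_le_sum (f := fun i => p i j) (fun _ _ => Nat.zero_le _)
      (Finset.mem_univ i))
  have hpy : ∀ i, ∑ j, p i j * y j = d * y i := fun i => by
    simp only [y, Finset.mul_sum]
    rw [Finset.sum_comm]
    exact Finset.sum_congr rfl fun k _ => hsq i k
  have hzp : ∀ k, ∑ j, z j * p j k = d * z k := fun k => by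
    simp only [z, Finset.mul_sum, Finset.sum_mul]
    rw [Finset.sum_comm]
    exact Finset.sum_congr rfl fun i _ => hsq i k
  have hle : ∀ x ∈ (Finset.univ : Finset (ι × ι)), z x.1 * (c x.1 * p x.1 x.2) * y x.2 ≤
      z x.1 * (c x.2 * p x.1 x.2) * y x.2 := fun x _ =>
    Nat.mul_le_mul_right _ (Nat.mul_le_mul_left _ (hc _ _))
  have hsum : ∑ x : ι × ι, z x.1 * (c x.1 * p x.1 x.2) * y x.2 =
      ∑ x : ι × ι, z x.1 * (c x.2 * p x.1 x.2) * y x.2 := by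
    rw [Fintype.sum_prod_type, Fintype.sum_prod_type_right]
    refine Finset.sum_congr rfl fun i _ => ?_
    calc ∑ j, z i * (c i * p i j) * y j = z i * c i * ∑ j, p i j * y j := by
          rw [Finset.mul_sum]; exact Finset.sum_congr rfl fun j _ => by ring
      _ = (∑ j, z j * p j i) * (c i * y i) := by rw [hpy, hzp]; ring
      _ = ∑ j, z j * (c i * p j i) * y i := by
          rw [Finset.sum_mul]; exact Finset.sum_congr rfl fun j _ => by ring
  have := (Finset.sum_eq_sum_iff_of_le hle).1 hsum (a, b) (Finset.mem_univ _)
  exact Nat.eq_of_mul_eq_mul_left (hz a) (Nat.eq_of_mul_eq_mul_right (hy b) this)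

theorem pos_trans_of_sq_eq_mul {p : ι → ι → ℕ} {d : ℕ}
    (hsq : ∀ i k, ∑ j, p i j * p j k = d * p i k) {i j k : ι} (hij : 0 < p i j)
    (hjk : 0 < p j k) : 0 < p i k := by
  refine Nat.pos_of_ne_zero fun h => ?_
  have := hsq i k
  rw [h, mul_zero, Finset.sum_eq_zero_iff] at this
  exact (Nat.mul_pos hij hjk).ne' (this j (Finset.mem_univ _))

theorem pos_symm_of_sq_eq_mul {p : ι → ι → ℕ} {d : ℕ}
    (hsq : ∀ i k, ∑ j, p i j * p j k = d * p i k)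
    (hrow : ∀ i, ∃ j, 0 < p i j) (hcol : ∀ j, ∃ i, 0 < p i j) {i j : ι} (hij : 0 < p i j) :
    0 < p j i := by
  classical
  have hout : ∀ i a b, 0 < p a b → (0 < p i a ↔ 0 < p i b) := by
    intro i a b hab
    -- The set of successors of `i` is closed along edges by transitivity; applied to its indicator
    -- function, the circulation argument makes it closed backwards as well.
    have := mul_eq_mul_of_mul_le_mul_of_sq_eq_mul hsq hrow hcol
      (fun a => if 0 < p i a then 1 else 0) (fun a b => ?_) a b
    · have h := Nat.eq_of_mul_eq_mul_right hab this
      by_cases h1 : 0 < p i a <;> by_cases h2 : 0 < p i b <;> simp_all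
    · by_cases hab : 0 < p a b
      · by_cases h1 : 0 < p i a
        · simp [h1, pos_trans_of_sq_eq_mul hsq h1 hab]
        · simp [h1]
      · simp [Nat.eq_zero_of_not_pos hab]
  have hjj : 0 < p j j := by
    obtain ⟨k, hk⟩ := hrow j
    exact (hout j j k hk).2 hk
  exact (hout j i j hij).2 hjj

/-- The column sums `z` satisfy `z p = d z` and are positive, so summing the inequalities with
weights `z` yields an equality, which must hold termwise. -/
theorem eq_sum_of_forall_le_of_sq_eq_mul {p : ι → ι → ℕ} {d : ℕ}
    (hsq : ∀ i k, ∑ j, p i j * p j k = d * p i k) (hcol : ∀ j, ∃ i, 0 < p i j) {g : ι → ℕ}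
    (hle : ∀ i, d * g i ≤ ∑ j, p i j * g j) (i : ι) : d * g i = ∑ j, p i j * g j := by
  obtain ⟨z, hz⟩ : ∃ z : ι → ℕ, ∀ j, z j = ∑ h, p h j := ⟨_, fun _ => rfl⟩
  have hle' : ∀ i ∈ Finset.univ, z i * (d * g i) ≤ z i * ∑ j, p i j * g j :=
    fun i _ => Nat.mul_le_mul_left _ (hle i)
  have hzp : ∀ j, ∑ i, z i * p i j = d * z j := fun j => by
    simp only [hz, Finset.sum_mul, Finset.mul_sum]
    rw [Finset.sum_comm]
    exact Finset.sum_congr rfl fun h _ => hsq h j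
  have hsum : ∑ i, z i * (d * g i) = ∑ i, z i * ∑ j, p i j * g j := by
    calc ∑ j, z j * (d * g j) = ∑ j, (∑ i, z i * p i j) * g j :=
          Finset.sum_congr rfl fun j _ => by rw [hzp]; ring
      _ = ∑ i, z i * ∑ j, p i j * g j := by
          simp only [Finset.sum_mul, Finset.mul_sum, mul_assoc]
          exact Finset.sum_comm
  refine Nat.eq_of_mul_eq_mul_left ?_
    ((Finset.sum_eq_sum_iff_of_le hle').1 hsum i (Finset.mem_univ i))
  obtain ⟨h, hh⟩ := hcol i
  rw [hz]
  exact hh.trans_le (Finset.single_le_sum (f := fun h => p h i)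
    (fun _ _ => Nat.zero_le _) (Finset.mem_univ h))

/-- A Perron–Frobenius argument: at an index `m` minimizing `g i k / g i k'`, the fixed-point
equations express a positively weighted sum of terms of one sign as zero. All ratios thus equal the
minimum, and `g` has rank one. -/
theorem mul_eq_mul_of_forall_fixed {p g : ι → ι → ℕ} {d : ℕ} (hp : ∀ i j, 0 < p i j)
    (hg : ∀ i j, 0 < g i j)
    (hfix : ∀ i k, ∑ j, p i j * g j k = d * g i k) (i i' k k' : ι) :
    g i k * g i' k' = g i k' * g i' k := by
  obtain ⟨m, -, hm⟩ := Finset.exists_min_image Finset.univ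
    (fun i => (g i k : ℚ) / g i k') ⟨i, Finset.mem_univ i⟩
  have hle : ∀ j ∈ Finset.univ, p m j * (g m k * g j k') ≤ p m j * (g j k * g m k') := by
    intro j hj
    have := hm j hj
    rw [div_le_div_iff₀ (by exact_mod_cast hg m k') (by exact_mod_cast hg j k')] at this
    exact Nat.mul_le_mul_left _ (by exact_mod_cast this)
  have hsum : ∑ j, p m j * (g m k * g j k') = ∑ j, p m j * (g j k * g m k') := by
    calc ∑ j, p m j * (g m k * g j k') = g m k * ∑ j, p m j * g j k' := by
          rw [Finset.mul_sum]; exact Finset.sum_congr rfl fun j _ => by ring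
      _ = (∑ j, p m j * g j k) * g m k' := by rw [hfix, hfix]; ring
      _ = _ := by rw [Finset.sum_mul]; exact Finset.sum_congr rfl fun j _ => by ring
  have heq : ∀ j, g m k * g j k' = g j k * g m k' := fun j =>
    Nat.eq_of_mul_eq_mul_left (hp m j)
      ((Finset.sum_eq_sum_iff_of_le hle).1 hsum j (Finset.mem_univ j))
  refine Nat.eq_of_mul_eq_mul_left (hg m k') ?_
  calc g m k' * (g i k * g i' k') = (g i k * g m k') * g i' k' := by ring
    _ = (g m k * g i' k') * g i k' := by rw [← heq i]; ring
    _ = g m k' * (g i k' * g i' k) := by rw [heq i']; ring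

/-- Dividing each column by the gcd `G j` of its entries leaves the same primitive integer vector
for every column; this is `a`, and `r = G`. -/
theorem exists_eq_mul_of_mul_eq_mul [Nonempty ι] {g : ι → ι → ℕ} (hg : ∀ i j, 0 < g i j)
    (h : ∀ i i' k k', g i k * g i' k' = g i k' * g i' k) :
    ∃ a r : ι → ℕ, (∀ i, 0 < a i) ∧ (∀ j, 0 < r j) ∧ ∀ i j, g i j = a i * r j := by
  obtain ⟨k⟩ := ‹Nonempty ι›
  let G : ι → ℕ := fun j => Finset.univ.gcd fun i => g i j
  have hdvd : ∀ i j, G j ∣ g i j := fun i j => Finset.gcd_dvd (Finset.mem_univ i)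
  have hG : ∀ j, 0 < G j := fun j => Nat.pos_of_dvd_of_pos (hdvd j j) (hg j j)
  refine ⟨fun i => g i k / G k, G, fun i => Nat.div_pos (Nat.le_of_dvd (hg i k) (hdvd i k)) (hG k),
    hG, fun i j => ?_⟩
  have key : g i j * G k = g i k * G j := by
    have h1 := Finset.gcd_mul_left (s := Finset.univ) (f := fun i' => g i' k) (a := g i j)
    have h2 := Finset.gcd_mul_left (s := Finset.univ) (f := fun i' => g i' j) (a := g i k)
    rw [normalize_eq] at h1 h2
    rw [← h1, ← h2]
    exact Finset.gcd_congr rfl fun i' _ => h i i' j k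
  refine Nat.eq_of_mul_eq_mul_right (hG k) ?_
  rw [key, mul_right_comm, Nat.div_mul_cancel (hdvd i k)]

end NonnegativeMatrices

/-! ### Families of bimodules `C i j` with `⨁ j, C i j ⊗ C j k ≅ (C i k) ^ d`. -/

section Components

attribute [local instance] coordAlgebra

variable {ι : Type u} {K : ι → Type v} [∀ i, Field (K i)] {C : ι → ι → Type w}
  [∀ i j, AddCommGroup (C i j)] [∀ i j, Module (K i) (C i j)]

/-- For a family of `K i`-`K j`-bimodules `C i j` (with right actions `ρ`), the maps
`t i j k : C i j × C j k → (C i k) ^ d` exhibit `(C i k) ^ d` as `⨁ j, C i j ⊗ C j k`. -/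
structure IsTensorPower (ρ : ∀ i j, K j →+* Module.End (K i) (C i j)) (d : ℕ)
    (t : ∀ i j k, C i j →+ C j k →+ (Fin d → C i k)) : Prop where
  smul_left : ∀ i j k (a : K i) y x, t i j k (a • y) x = a • t i j k y x
  smul_right : ∀ i j k (b : K k) y x s, t i j k y (ρ j k b x) s = ρ i k b (t i j k y x s)
  balanced : ∀ i j k (c : K j) y x, t i j k (ρ i j c y) x = t i j k y (c • x)
  eq_top : ∀ i k (N : AddSubgroup (Fin d → C i k)), (∀ j y x, t i j k y x ∈ N) → N = ⊤
  functional : ∀ i j k (φ : C i j →ₗ[K i] K i) (ψ : C j k →ₗ[K j] K j),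
    ∃ Ω : (Fin d → C i k) →ₗ[K i] K i, (∀ y x, Ω (t i j k y x) = φ (ρ i j (ψ x) y)) ∧
      ∀ j', j' ≠ j → ∀ y x, Ω (t i j' k y x) = 0
  contraction : ∀ i j k (l : C i j →+ K j), (∀ c y, l (ρ i j c y) = c * l y) →
    ∃ Λ : (Fin d → C i k) →+ C j k, ∀ y x, Λ (t i j k y x) = l y • x

variable {ρ : ∀ i j, K j →+* Module.End (K i) (C i j)} {d : ℕ}
  {t : ∀ i j k, C i j →+ C j k →+ (Fin d → C i k)}

/-- Products of basis vectors form a basis of `(C i k) ^ d`: `functional` supplies dual coordinates,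
and `balanced` moves scalars of `K j` to the left factor. -/
theorem IsTensorPower.sum_finrank_mul_finrank [Fintype ι] [∀ i j, Module.Finite (K i) (C i j)]
    (ht : IsTensorPower ρ d t) (i k : ι) :
    ∑ j, Module.finrank (K i) (C i j) * Module.finrank (K j) (C j k) =
      d * Module.finrank (K i) (C i k) := by
  classical
  let y := fun j => Module.finBasis (K i) (C i j)
  let x := fun j => Module.finBasis (K j) (C j k)
  let b : (Σ j, Fin (Module.finrank (K i) (C i j)) × Fin (Module.finrank (K j) (C j k))) →
      (Fin d → C i k) := fun e => t i e.1 k (y e.1 e.2.1) (x e.1 e.2.2)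
  have hli : LinearIndependent (K i) b := by
    rw [Fintype.linearIndependent_iff]
    rintro l hl ⟨j, s, r⟩
    obtain ⟨Ω, hΩ, hΩ'⟩ := ht.functional i j k ((y j).coord s) ((x j).coord r)
    have h := congrArg Ω hl
    rw [map_sum, map_zero, Fintype.sum_eq_single ⟨j, s, r⟩] at h
    · simpa [b, hΩ] using h
    · rintro ⟨j', s', r'⟩ hne
      by_cases hj : j' = j
      · subst hj
        rw [map_smul]
        simp only [b, hΩ, Module.Basis.coord_apply, Module.Basis.repr_self]
        by_cases hr : r' = r
        · subst hr
          have hs : s' ≠ s := fun hs => hne (by rw [hs])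
          simp [hs]
        · simp [hr]
      · rw [map_smul]
        simp only [b, hΩ' j' hj, smul_zero]
  have hspan : ⊤ ≤ Submodule.span (K i) (Set.range b) := by
    have := ht.eq_top i k (Submodule.span (K i) (Set.range b)).toAddSubgroup fun j y' x' => ?_
    · exact fun z _ => (this.ge (AddSubgroup.mem_top z) : _)
    rw [Submodule.mem_toAddSubgroup, ← (x j).sum_repr x', map_sum]
    refine Submodule.sum_mem _ fun r _ => ?_
    rw [← ht.balanced, ← (y j).sum_repr (ρ i j _ y'), map_sum, AddMonoidHom.finsetSum_apply]
    refine Submodule.sum_mem _ fun s _ => ?_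
    rw [ht.smul_left]
    exact Submodule.smul_mem _ _ (Submodule.subset_span ⟨⟨j, s, r⟩, rfl⟩)
  have h1 := Module.finrank_eq_card_basis (Module.Basis.mk hli hspan)
  have h2 := Module.finrank_pi_fintype (K i) (M := fun _ : Fin d => C i k)
  simp only [Fintype.card_sigma, Fintype.card_prod, Fintype.card_fin] at h1
  rw [← h1, h2]
  simp

theorem exists_semilinear_functional {E V : Type*} [Field E] [AddCommGroup V]
    (σ : E →+* AddMonoid.End V) (y v : V) (h : ∀ c, v ≠ σ c y) :
    ∃ l : V →+ E, (∀ c w, l (σ c w) = c * l w) ∧ l y = 0 ∧ l v ≠ 0 := by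
  let : Module E V := Module.compHom V σ
  have hv : v ∉ Submodule.span E {y} := fun hv => by
    obtain ⟨c, hc⟩ := Submodule.mem_span_singleton.1 hv
    exact h c hc.symm
  obtain ⟨f, hfv, hf⟩ := Submodule.exists_le_ker_of_notMem hv
  exact ⟨f.toAddMonoidHom, fun c w => f.map_smul c w,
    hf (Submodule.mem_span_singleton_self y), hfv⟩

/-- Transport of relations from index `h` to index `i`: the given relation holds on every component
of `t h i j y x`, and contracting the left factor with `l` leaves a relation on `C i j`. -/
theorem IsTensorPower.exists_contraction (ht : IsTensorPower ρ d t) {κ : Type*} [Fintype κ] {h j : ι}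
    {b : κ → K j} {v : κ → K h} (hv : ∀ x : C h j, ∑ k, v k • ρ h j (b k) x = 0)
    (i : ι) (l : C h i →+ K i) (hl : ∀ c y, l (ρ h i c y) = c * l y) (y : C h i) (x : C i j) :
    ∑ k, l (v k • y) • ρ i j (b k) x = 0 := by
  obtain ⟨Λ, hΛ⟩ := ht.contraction h i j l hl
  simp only [← hΛ, ← map_sum]
  rw [← map_zero Λ]
  congr 1
  funext s
  rw [Finset.sum_apply, Pi.zero_apply, ← hv (t h i j y x s)]
  refine Finset.sum_congr rfl fun k _ => ?_
  rw [ht.smul_left, Pi.smul_apply, ht.smul_right]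

/-! ### Independence over the center, and finiteness of each `K j` over it. -/

section Center

variable [∀ i j, Nontrivial (C i j)] {Z : Subring (∀ i, K i)}

theorem apply_ne_zero_of_ne_zero (i j : ι) {c : K j} (hc : c ≠ 0) {x : C i j} (hx : x ≠ 0) :
    ρ i j c x ≠ 0 := fun h => hx <| by
  have := congrArg (ρ i j c⁻¹) h
  rwa [← Module.End.mul_apply, ← map_mul, inv_mul_cancel₀ hc, map_one, map_zero] at this

variable (hZ : ∀ z, z ∈ Z ↔ ∀ i j (x : C i j), z i • x = ρ i j (z j) x)
include hZ

theorem IsTensorPower.eq_zero_of_sum_smul_eq_zero (ht : IsTensorPower ρ d t) {κ : Type*}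
    [Fintype κ] {j : ι} {b : κ → K j} (hb : LinearIndependent Z b) {i : ι} (a : κ → K i)
    (ha : ∀ x : C i j, ∑ k, a k • ρ i j (b k) x = 0) : a = 0 := by
  classical
  by_contra hne
  let rel : ∀ i, (κ → K i) → Prop := fun i v => ∀ x : C i j, ∑ k, v k • ρ i j (b k) x = 0
  let supp : ∀ i, (κ → K i) → Finset κ := fun i v => Finset.univ.filter fun k => v k ≠ 0
  -- The length is minimized over all left indices `i` at once, so that transported relations can be
  -- compared with the shortest one.
  have hex : ∃ n i, ∃ v : κ → K i, rel i v ∧ v ≠ 0 ∧ (supp i v).card = n :=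
    ⟨_, i, a, ha, hne, rfl⟩
  obtain ⟨h, v, hv, hv0, hvn⟩ := Nat.find_spec hex
  have hmin : ∀ i (u : κ → K i), rel i u → supp i u ⊂ supp h v → u = 0 := by
    intro i u hu hsub
    by_contra hu0
    exact Nat.find_min hex (hvn ▸ Finset.card_lt_card hsub) ⟨i, u, hu, hu0, rfl⟩
  obtain ⟨k₀, hk₀⟩ := Function.ne_iff.1 hv0
  let good : ∀ i, (κ → K i) → Prop := fun i u => rel i u ∧ supp i u ⊆ supp h v ∧ u k₀ = 1
  have hlt : ∀ i (u : κ → K i), rel i u → supp i u ⊆ supp h v → u k₀ = 0 → u = 0 := by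
    intro i u hu hsub h0
    refine hmin i u hu (Finset.ssubset_iff_subset_ne.2 ⟨hsub, fun heq => ?_⟩)
    have : k₀ ∈ supp i u := heq ▸ Finset.mem_filter.2 ⟨Finset.mem_univ _, hk₀⟩
    exact (Finset.mem_filter.1 this).2 h0
  have huniq : ∀ i (u u' : κ → K i), good i u → good i u' → u = u' := by
    rintro i u u' ⟨hu, hs, h1⟩ ⟨hu', hs', h1'⟩
    refine sub_eq_zero.1 (hlt i (u - u') (fun x => ?_) (fun k hk => ?_) (by simp [h1, h1']))
    · simp only [Pi.sub_apply, sub_smul, Finset.sum_sub_distrib]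
      rw [hu x, hu' x, sub_zero]
    · by_contra hk'
      have e1 : u k = 0 := by
        by_contra h0; exact hk' (hs (Finset.mem_filter.2 ⟨Finset.mem_univ _, h0⟩))
      have e2 : u' k = 0 := by
        by_contra h0; exact hk' (hs' (Finset.mem_filter.2 ⟨Finset.mem_univ _, h0⟩))
      exact (Finset.mem_filter.1 hk).2 (by simp [e1, e2])
  have hscale : ∀ i (u : κ → K i) (e : K i), rel i u → rel i (e • u) := fun i u e hu x => by
    have := congrArg (e • ·) (hu x)
    simpa only [Finset.smul_sum, smul_zero, smul_smul, Pi.smul_apply, smul_eq_mul] using this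
  have hnorm : good h ((v k₀)⁻¹ • v) := by
    refine ⟨hscale _ _ _ hv, fun k hk => ?_, ?_⟩
    · refine Finset.mem_filter.2 ⟨Finset.mem_univ _, fun h0 => ?_⟩
      exact (Finset.mem_filter.1 hk).2 (by simp [h0])
    · simpa using inv_mul_cancel₀ hk₀
  -- A right-linear functional `l` killing `y` transports `u` to a relation whose `k₀`-coefficient
  -- is `l y = 0`, hence to zero. So every such `l` kills `u k • y`, which must then lie in `y K i`.
  have hstep : ∀ m (u : κ → K m), good m u → ∀ i (y : C m i), y ≠ 0 →
      ∃ c : κ → K i, good i c ∧ ∀ k, u k • y = ρ m i (c k) y := by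
    rintro m u ⟨hu, hs, h1⟩ i y hy
    let σ : K i →+* AddMonoid.End (C m i) := (Module.toAddMonoidEnd (Module.End (K m) (C m i)) (C m i)).comp (ρ m i)
    have hsub : ∀ l : C m i →+ K i, supp i (fun k => l (u k • y)) ⊆ supp h v := by
      intro l k hk
      refine hs (Finset.mem_filter.2 ⟨Finset.mem_univ _, fun h0 => ?_⟩)
      exact (Finset.mem_filter.1 hk).2 (by simp [h0])
    have hc : ∀ k, ∃ c, u k • y = ρ m i c y := by
      intro k
      by_contra! hk
      obtain ⟨l, hl, hly, hlk⟩ := exists_semilinear_functional σ y (u k • y) hk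
      have := hlt i _ (ht.exists_contraction hu i l hl y) (hsub l) (by simp [h1, hly])
      exact hlk (congrFun this k)
    choose c hc using hc
    obtain ⟨l, hl, -, hly⟩ := exists_semilinear_functional σ 0 y fun c => by simpa using hy
    have hlc : (fun k => l (u k • y)) = l y • c := funext fun k => by
      rw [hc]
      exact (hl (c k) y).trans (mul_comm _ _)
    have hck : (l y)⁻¹ • (fun k => l (u k • y)) = c := by
      rw [hlc, smul_smul, inv_mul_cancel₀ hly, one_smul]
    refine ⟨c, ⟨?_, ?_, ?_⟩, hc⟩
    · rw [← hck]
      exact hscale _ _ _ (ht.exists_contraction hu i l hl y)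
    · intro k hk
      refine hsub l (Finset.mem_filter.2 ⟨Finset.mem_univ _, fun h0 => ?_⟩)
      exact mul_ne_zero hly (Finset.mem_filter.1 hk).2 ((congrFun hlc k).symm.trans h0)
    · rw [← hck, Pi.smul_apply, h1, one_smul, smul_eq_mul, inv_mul_cancel₀ hly]
  have hall : ∀ i, ∃ c : κ → K i, good i c := fun i => by
    obtain ⟨y, hy⟩ := exists_ne (0 : C h i)
    obtain ⟨c, hc, -⟩ := hstep h _ hnorm i y hy
    exact ⟨c, hc⟩
  choose c hc using hall
  -- The normalized relation at each index is unique, so `c i k • y = y (c i' k)` for all `y` in `C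
  -- i i'`.
  have hcen : ∀ k, (fun i => c i k) ∈ Z := fun k => (hZ _).2 fun i i' y => by
    by_cases hy : y = 0
    · simp [hy]
    obtain ⟨c', hc', h'⟩ := hstep i _ (hc i) i' y hy
    rw [h' k, huniq i' _ _ hc' (hc i')]
  obtain ⟨x, hx⟩ := exists_ne (0 : C j j)
  -- Central coefficients pass through `x`, which turns the relation into one over `Z` between the
  -- `b k`, with coefficient `1` at `k₀`.
  have hsum : ∑ k, c j k * b k = 0 := by
    by_contra h0
    refine apply_ne_zero_of_ne_zero (ρ := ρ) j j h0 hx ?_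
    rw [map_sum, LinearMap.sum_apply, ← (hc j).1 x]
    refine Finset.sum_congr rfl fun k _ => ?_
    rw [mul_comm, map_mul, Module.End.mul_apply, ← (hZ _).1 (hcen k) j j x, map_smul]
  have := Fintype.linearIndependent_iff.1 hb (fun k => ⟨_, hcen k⟩) hsum k₀
  have h0 := congrFun (congrArg Subtype.val this) j
  exact one_ne_zero ((hc j).2.2.symm.trans h0)

/-- If one coordinate of a central `z` vanishes, `z i • x = x (z j)` on the nonzero `C i j` forces
all of them to vanish; so a nonzero `z` can be inverted coordinatewise. -/
theorem isField_of_mem_iff [Nonempty ι] : IsField Z := by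
  obtain ⟨i₀⟩ := ‹Nonempty ι›
  refine ⟨⟨0, 1, fun h => ?_⟩, mul_comm, fun {z} hz => ?_⟩
  · exact zero_ne_one (congrFun (congrArg Subtype.val h) i₀)
  have hne : ∀ i, z.1 i ≠ 0 := fun i hi => hz <| Subtype.ext <| funext fun j => by
    by_contra hj
    obtain ⟨x, hx⟩ := exists_ne (0 : C i j)
    have := (hZ _).1 z.2 i j x
    rw [hi, zero_smul] at this
    exact apply_ne_zero_of_ne_zero i j hj hx this.symm
  refine ⟨⟨fun i => (z.1 i)⁻¹, (hZ _).2 fun i j x => ?_⟩, Subtype.ext <| funext fun i =>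
    mul_inv_cancel₀ (hne i)⟩
  have := (hZ _).1 z.2 i j (ρ i j (z.1 j)⁻¹ x)
  rw [← Module.End.mul_apply, ← map_mul, mul_inv_cancel₀ (hne j), map_one] at this
  rw [inv_smul_eq_iff₀ (hne i), this, Module.End.one_apply]

theorem coordHom_injective_of_mem_iff (i : ι) : Function.Injective (coordHom Z i) := by
  rw [injective_iff_map_eq_zero]
  refine fun z hz => Subtype.ext <| funext fun j => ?_
  by_contra hj
  obtain ⟨x, hx⟩ := exists_ne (0 : C i j)
  have := (hZ _).1 z.2 i j x
  rw [show z.1 i = 0 from hz, zero_smul] at this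
  exact apply_ne_zero_of_ne_zero i j hj hx this.symm

theorem IsTensorPower.linearIndependent_rightAction (ht : IsTensorPower ρ d t) {κ : Type*} {i j : ι}
    {b : κ → K j} (hb : LinearIndependent Z b) :
    LinearIndependent (K i) fun k => ρ i j (b k) := by
  rw [linearIndependent_iff']
  intro s a ha k hk
  have hb' : LinearIndependent Z fun k : s => b k := hb.comp _ Subtype.val_injective
  refine congrFun (ht.eq_zero_of_sum_smul_eq_zero hZ hb' (i := i) (fun k : s => a k) fun x => ?_)
    ⟨k, hk⟩
  have := LinearMap.congr_fun ha x
  rw [LinearMap.sum_apply, ← Finset.sum_coe_sort] at this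
  exact this

theorem free_of_mem_iff (j : ι) : Module.Free Z (K j) := by
  have : Nonempty ι := ⟨j⟩
  let := (isField_of_mem_iff hZ).toField
  exact Module.Free.of_basis (Module.Basis.ofVectorSpace Z (K j))

/-- A `Z`-basis of `K j` gives independent elements of the finite-dimensional space of endomorphisms
of `C j j`. -/
theorem IsTensorPower.coordHom_finite [∀ i j, Module.Finite (K i) (C i j)]
    (ht : IsTensorPower ρ d t) (j : ι) : (coordHom Z j).Finite := by
  have := free_of_mem_iff hZ j
  let b := Module.Free.chooseBasis Z (K j)
  have : Finite (Module.Free.ChooseBasisIndex Z (K j)) :=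
    (ht.linearIndependent_rightAction hZ b.linearIndependent (i := j)).finite
  exact Module.Finite.of_basis b

end Center

end Components

/-! ### `C i j` as a module over `K i ⊗[Z] K j`, and coefficient maps. -/

section Freeness

attribute [local instance] coordAlgebra

variable {ι : Type u} {K : ι → Type v} [∀ i, Field (K i)] {C : ι → ι → Type w}
  [∀ i j, AddCommGroup (C i j)] [∀ i j, Module (K i) (C i j)]
  {ρ : ∀ i j, K j →+* Module.End (K i) (C i j)} {d : ℕ}
  {t : ∀ i j k, C i j →+ C j k →+ (Fin d → C i k)}
  [∀ i j, Nontrivial (C i j)] {Z : Subring (∀ i, K i)}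

variable (hZ : ∀ z, z ∈ Z ↔ ∀ i j (x : C i j), z i • x = ρ i j (z j) x)

/-- The action of `K i ⊗[Z] K j` on a `K i`-`K j`-bimodule on which `Z` acts centrally. -/
def tensorAction (i j : ι) : K i ⊗[Z] K j →+* AddMonoid.End (C i j) :=
  { TensorProduct.liftAddHom
      ((AddMonoidHom.mul (R := AddMonoid.End (C i j))).comp
        (Module.toAddMonoidEnd (K i) (C i j)).toAddMonoidHom |>.compl₂
        ((Module.toAddMonoidEnd (Module.End (K i) (C i j)) (C i j)).comp (ρ i j)).toAddMonoidHom)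
      (fun z a b => AddMonoidHom.ext fun x => by
        change (z.1 i * a) • ρ i j b x = a • ρ i j (z.1 j * b) x
        rw [map_mul, Module.End.mul_apply, ← (hZ _).1 z.2 i j, smul_smul, mul_comm]) with
    map_one' := by
      refine AddMonoidHom.ext fun x => ?_
      change (1 : K i) • ρ i j 1 x = x
      rw [one_smul, map_one, Module.End.one_apply]
    map_mul' := by
      intro s s'
      induction s using TensorProduct.induction_on with
      | zero => simp
      | add s₁ s₂ h₁ h₂ => simp_all [add_mul]
      | tmul a b =>
        induction s' using TensorProduct.induction_on with
        | zero => simp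
        | add s₁ s₂ h₁ h₂ => simp_all [mul_add]
        | tmul a' b' =>
          refine AddMonoidHom.ext fun x => ?_
          rw [Algebra.TensorProduct.tmul_mul_tmul]
          change (a * a') • ρ i j (b * b') x = a • ρ i j b (a' • ρ i j b' x)
          rw [map_smul, smul_smul, map_mul, Module.End.mul_apply] }

theorem tensorAction_tmul (i j : ι) (a : K i) (b : K j) (x : C i j) :
    tensorAction hZ i j (a ⊗ₜ b) x = a • ρ i j b x := rfl

variable [∀ i j, Module (K i ⊗[Z] K j) (C i j)]
  (hsmul : ∀ i j (a : K i) (b : K j) (x : C i j), (a ⊗ₜ[Z] b) • x = a • ρ i j b x)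

include hsmul in
theorem isScalarTower_of_tmul_smul (i j : ι) : IsScalarTower (K i) (K i ⊗[Z] K j) (C i j) where
  smul_assoc a s x := by
    induction s using TensorProduct.induction_on with
    | zero => simp
    | add s₁ s₂ h₁ h₂ => rw [smul_add, add_smul, add_smul, h₁, h₂, smul_add]
    | tmul a' b' => rw [TensorProduct.smul_tmul', hsmul, hsmul, smul_smul, smul_eq_mul]

section Coefficients

/-- For `y` in `C i j` and a linear form `φ` on `C i j`, the map `c ↦ φ (y c)`, which is linear over
the center. -/
def coefficientMap {i j : ι} (φ : C i j →ₗ[K i] K i) (y : C i j) : K j →ₗ[Z] K i where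
  toFun c := φ (ρ i j c y)
  map_add' c c' := by rw [map_add, LinearMap.add_apply, map_add]
  map_smul' z c := by
    change φ (ρ i j (z.1 j * c) y) = z.1 i * φ (ρ i j c y)
    rw [map_mul, Module.End.mul_apply, ← (hZ _).1 z.2 i j, map_smul, smul_eq_mul]

include hsmul in
theorem IsTensorPower.apply_smul (ht : IsTensorPower ρ d t) {i j k : ι} {κ : Type*} [Fintype κ]
    (Y : Module.Basis κ (K i) (C i j)) (y : C i j) (x : C j k) (ν : K j ⊗[Z] K k) :
    t i j k y (ν • x) =
      ∑ s, (coefficientMap hZ (Y.coord s) y).rTensor (K k) ν • t i j k (Y s) x := by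
  induction ν using TensorProduct.induction_on with
  | zero => simp
  | add ν₁ ν₂ h₁ h₂ => simp only [add_smul, map_add, h₁, h₂, Finset.sum_add_distrib]
  | tmul c b =>
    -- The scalar `c` is moved across the product onto `y`, and `y c` is then expanded in the basis
    -- `Y`.
    rw [hsmul, ← ht.balanced]
    conv_lhs => rw [← Y.sum_repr (ρ i j c y), map_sum, AddMonoidHom.finsetSum_apply]
    refine Finset.sum_congr rfl fun s _ => ?_
    rw [LinearMap.rTensor_tmul, ht.smul_left]
    funext e
    rw [Pi.smul_apply, Pi.smul_apply, hsmul, ht.smul_right]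
    rfl

include hsmul in
-- The coefficient maps span `Hom_Z(K j, K i)` over `K i`, by independence over `Z`. If they all
-- send `ν = ∑ c u ⊗ β u` into the annihilator of `σ`, then `σ * (1 ⊗ β u) = 0` for each `u`; a
-- nonzero `β u` would make `1 ⊗ β u` a unit and `σ` zero.
theorem IsTensorPower.eq_zero_of_mul_rTensor_eq_zero [∀ i j, Module.Finite (K i) (C i j)]
    (ht : IsTensorPower ρ d t) {i j k : ι}
    {κ : Type*} (Y : Module.Basis κ (K i) (C i j)) {σ : K i ⊗[Z] K k} (hσ : σ ≠ 0)
    (ν : K j ⊗[Z] K k)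
    (h : ∀ y s, σ * (coefficientMap hZ (Y.coord s) y).rTensor (K k) ν = 0) : ν = 0 := by
  classical
  have := free_of_mem_iff hZ j
  have : Module.Finite Z (K j) := ht.coordHom_finite hZ j
  let c := Module.Free.chooseBasis Z (K j)
  obtain ⟨β, hβ⟩ := TensorProduct.eq_repr_basis_left c ν
  rw [Finsupp.sum_fintype _ _ (by simp)] at hβ
  let f : (Module.Free.ChooseBasisIndex Z (K j) → K i) →ₗ[K i] K i ⊗[Z] K k :=
    { toFun := fun w => σ * ∑ u, w u ⊗ₜ[Z] β u
      map_add' := fun w w' => by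
        simp only [Pi.add_apply, TensorProduct.add_tmul, Finset.sum_add_distrib, mul_add]
      map_smul' := fun a w => by
        simp only [Pi.smul_apply, ← TensorProduct.smul_tmul', ← Finset.smul_sum, mul_smul_comm,
          RingHom.id_apply] }
  have hf : ∀ y s, (fun u => Y.coord s (ρ i j (c u) y)) ∈ LinearMap.ker f := fun y s => by
    rw [LinearMap.mem_ker, ← h y s, ← hβ, map_sum]
    rfl
  -- A nonzero functional vanishing on this kernel would be a `K i`-linear relation between the
  -- right actions of the basis elements `c u` on `C i j`.
  have htop : LinearMap.ker f = ⊤ := by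
    by_contra hne
    obtain ⟨l, hl0, hl⟩ := Submodule.exists_le_ker_of_lt_top _ (lt_top_iff_ne_top.2 hne)
    have hsum : ∀ w, l w = ∑ u, l (Pi.single u 1) * w u := fun w => by
      conv_lhs => rw [← Finset.univ_sum_single w, map_sum]
      refine Finset.sum_congr rfl fun u _ => ?_
      rw [mul_comm, ← smul_eq_mul, ← map_smul, ← Pi.single_smul', smul_eq_mul, mul_one]
    have h0 := ht.eq_zero_of_sum_smul_eq_zero hZ c.linearIndependent (i := i)
      (fun u => l (Pi.single u 1)) fun y => Y.ext_elem fun s => by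
        have := LinearMap.mem_ker.1 (hl (hf y s))
        rw [hsum] at this
        simpa [map_sum] using this
    exact hl0 (LinearMap.ext fun w => by
      rw [hsum]; exact Finset.sum_eq_zero fun u _ => by rw [congrFun h0 u]; simp)
  have hβ0 : ∀ u, β u = 0 := fun u => by
    by_contra hu
    have h1 : f (Pi.single u 1) = 0 := LinearMap.mem_ker.1 (htop ▸ Submodule.mem_top)
    change σ * ∑ u', (Pi.single u (1 : K i) : _ → K i) u' ⊗ₜ[Z] β u' = 0 at h1
    rw [Fintype.sum_eq_single u fun u' hu' => by
      rw [Pi.single_eq_of_ne hu', TensorProduct.zero_tmul], Pi.single_eq_same] at h1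
    refine hσ ?_
    have := congrArg (· * ((1 : K i) ⊗ₜ[Z] (β u)⁻¹)) h1
    simpa [mul_assoc, mul_inv_cancel₀ hu, ← Algebra.TensorProduct.one_def] using this
  rw [← hβ]
  exact Finset.sum_eq_zero fun u _ => by rw [hβ0, TensorProduct.tmul_zero]

end Coefficients

end Freeness

/-! ### Freeness of `C i j` over `K i ⊗[Z] K j`. -/

section Freeness

attribute [local instance] coordAlgebra

variable {ι : Type u} {K : ι → Type v} [∀ i, Field (K i)] {C : ι → ι → Type w}
  [∀ i j, AddCommGroup (C i j)] [∀ i j, Module (K i) (C i j)]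
  {ρ : ∀ i j, K j →+* Module.End (K i) (C i j)} {d : ℕ}
  {t : ∀ i j k, C i j →+ C j k →+ (Fin d → C i k)}
  [∀ i j, Nontrivial (C i j)] {Z : Subring (∀ i, K i)}
  (hZ : ∀ z, z ∈ Z ↔ ∀ i j (x : C i j), z i • x = ρ i j (z j) x)
  [∀ i j, Module (K i ⊗[Z] K j) (C i j)]
  (hsmul : ∀ i j (a : K i) (b : K j) (x : C i j), (a ⊗ₜ[Z] b) • x = a • ρ i j b x)
  [∀ i j, Module.Finite (K i) (C i j)]

include hZ in
theorem IsTensorPower.isArtinianRing_tensor (ht : IsTensorPower ρ d t) (i j : ι) :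
    IsArtinianRing (K i ⊗[Z] K j) := by
  have : Module.Finite Z (K j) := ht.coordHom_finite hZ j
  exact IsArtinianRing.of_finite (K i) _

include hsmul in
theorem finite_of_tmul_smul (i j : ι) : Module.Finite (K i ⊗[Z] K j) (C i j) := by
  have := isScalarTower_of_tmul_smul hsmul i j
  exact Module.Finite.of_restrictScalars_finite (K i) _ _

variable [Fintype ι]

include hZ hsmul in
theorem IsTensorPower.span_range_eq_top (ht : IsTensorPower ρ d t) (i k : ι) {g : ι → ℕ}
    (x : ∀ j, Fin (g j) → C j k) (hx : ∀ j, Submodule.span (K j ⊗[Z] K k) (Set.range (x j)) = ⊤) :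
    Submodule.span (K i ⊗[Z] K k)
      (Set.range fun e : Σ j, Fin (Module.finrank (K i) (C i j)) × Fin (g j) =>
        t i e.1 k (Module.finBasis (K i) (C i e.1) e.2.1) (x e.1 e.2.2)) = ⊤ := by
  rw [← Submodule.toAddSubgroup_inj]
  refine ht.eq_top i k _ fun j y x' => ?_
  obtain ⟨ν, rfl⟩ := (Submodule.mem_span_range_iff_exists_fun _).1
    ((hx j).ge (Submodule.mem_top : x' ∈ ⊤))
  rw [map_sum]
  refine sum_mem fun r _ => ?_
  rw [ht.apply_smul hZ hsmul (Module.finBasis (K i) (C i j))]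
  refine Submodule.sum_mem _ fun s _ => Submodule.smul_mem _ _ (Submodule.subset_span ?_)
  exact ⟨⟨j, s, r⟩, rfl⟩

include hsmul in
theorem IsTensorPower.sum_rTensor_smul_eq_zero (ht : IsTensorPower ρ d t) (i k : ι) {g : ι → ℕ}
    (x : ∀ j, Fin (g j) → C j k) (ν : ∀ j, Fin (g j) → K j ⊗[Z] K k)
    (hν : ∀ j, ∑ r, ν j r • x j r = 0) (Y : ∀ j, C i j) :
    ∑ e : (Σ j, Fin (Module.finrank (K i) (C i j)) × Fin (g j)),
      (coefficientMap hZ ((Module.finBasis (K i) (C i e.1)).coord e.2.1) (Y e.1)).rTensor (K k)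
        (ν e.1 e.2.2) • t i e.1 k (Module.finBasis (K i) (C i e.1) e.2.1) (x e.1 e.2.2) = 0 := by
  rw [Fintype.sum_sigma]
  refine Finset.sum_eq_zero fun j _ => ?_
  have := congrArg (t i j k (Y j)) (hν j)
  rw [map_sum, map_zero] at this
  rw [Fintype.sum_prod_type_right, ← this]
  refine Finset.sum_congr rfl fun r _ => ?_
  rw [ht.apply_smul hZ hsmul (Module.finBasis (K i) (C i j))]

include hZ hsmul in
-- At `α i k` the module `(C i k) ^ d` needs `d * g i k` generators, and the products supply as many
-- as the right side. The eigenvector argument turns these inequalities into equalities.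
theorem IsTensorPower.mul_eq_sum_finrank_mul (ht : IsTensorPower ρ d t) {g : ι → ι → ℕ}
    (x : ∀ j k, Fin (g j k) → C j k)
    (hx : ∀ j k, Submodule.span (K j ⊗[Z] K k) (Set.range (x j k)) = ⊤)
    (α : ∀ j k, Ideal (K j ⊗[Z] K k)) (hα : ∀ j k, (α j k).IsMaximal)
    (hg : ∀ j k, g j k = Module.finrank (K j ⊗[Z] K k ⧸ α j k)
      (C j k ⧸ α j k • (⊤ : Submodule (K j ⊗[Z] K k) (C j k)))) (i k : ι) :
    d * g i k = ∑ j, Module.finrank (K i) (C i j) * g j k := by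
  have hfin := finite_of_tmul_smul hsmul
  refine eq_sum_of_forall_le_of_sq_eq_mul (g := fun i => g i k) ht.sum_finrank_mul_finrank
    (fun i => ⟨i, Module.finrank_pos⟩) (fun i => ?_) i
  have := Module.finrank_quotient_le_card _
      (ht.span_range_eq_top hZ hsmul i k (fun j => x j k) fun j => hx j k) (α i k)
  rwa [Module.finrank_pi_quotient_smul_top, ← hg, Fintype.card_sigma, Finset.sum_congr rfl
    fun j _ => by rw [Fintype.card_prod, Fintype.card_fin, Fintype.card_fin]] at this

include hZ hsmul in
/-- If every `C j k` is generated by as many elements as it needs at some maximal ideal, then these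
generators are independent. -/
theorem IsTensorPower.linearIndependent_generators (ht : IsTensorPower ρ d t) {g : ι → ι → ℕ}
    (x : ∀ j k, Fin (g j k) → C j k)
    (hx : ∀ j k, Submodule.span (K j ⊗[Z] K k) (Set.range (x j k)) = ⊤)
    (α : ∀ j k, Ideal (K j ⊗[Z] K k)) (hα : ∀ j k, (α j k).IsMaximal)
    (hg : ∀ j k, g j k = Module.finrank (K j ⊗[Z] K k ⧸ α j k)
      (C j k ⧸ α j k • (⊤ : Submodule (K j ⊗[Z] K k) (C j k)))) (j k : ι) :
    LinearIndependent (K j ⊗[Z] K k) (x j k) := by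
  classical
  have hfin := finite_of_tmul_smul hsmul
  rw [Fintype.linearIndependent_iff]
  intro ν hν r
  have := ht.isArtinianRing_tensor hZ j k
  obtain ⟨σ, hσ, hασ⟩ := IsArtinianRing.exists_ne_zero_forall_mem_mul_eq_zero (α j k)
  refine ht.eq_zero_of_mul_rTensor_eq_zero hZ hsmul (Module.finBasis (K j) (C j j)) hσ _
    fun y s => ?_
  rw [mul_comm]
  refine hασ _ ?_
  -- The relation `ν`, living at one middle index, is extended by zero to the others; the left
  -- multiplier is likewise `Pi.single j y`, with `y` in `C j j`.
  have hν' : ∀ j', ∑ r, (Pi.single j ν : ∀ j', Fin (g j' k) → K j' ⊗[Z] K k) j' r • x j' k r = 0 :=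
    fun j' => by
      by_cases hj : j' = j
      · subst hj
        rwa [Pi.single_eq_same]
      · rw [Pi.single_eq_of_ne hj]
        exact Finset.sum_eq_zero fun r _ => by rw [Pi.zero_apply, zero_smul]
  -- The number of products is exactly the local dimension at `α j k`, so any relation between them
  -- has coefficients in that ideal.
  have hcard : Fintype.card (Σ j', Fin (Module.finrank (K j) (C j j')) × Fin (g j' k)) =
      Module.finrank (K j ⊗[Z] K k ⧸ α j k)
        ((Fin d → C j k) ⧸ α j k • (⊤ : Submodule (K j ⊗[Z] K k) (Fin d → C j k))) := by
    rw [Module.finrank_pi_quotient_smul_top, ← hg, ht.mul_eq_sum_finrank_mul hZ hsmul x hx α hα hg,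
      Fintype.card_sigma]
    exact Finset.sum_congr rfl
      fun j _ => by rw [Fintype.card_prod, Fintype.card_fin, Fintype.card_fin]
  have := Module.mem_of_sum_smul_eq_zero_of_card_eq_finrank_quotient _
    (ht.span_range_eq_top hZ hsmul j k (fun j => x j k) fun j => hx j k) (α j k) hcard _
    (ht.sum_rTensor_smul_eq_zero hZ hsmul j k (fun j => x j k) _ hν' (Pi.single j y)) ⟨j, s, r⟩
  simp only [Pi.single_eq_same] at this
  exact this

include hZ hsmul in
theorem IsTensorPower.exists_linearEquiv (ht : IsTensorPower ρ d t) :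
    ∃ g : ι → ι → ℕ, (∀ i j, 0 < g i j) ∧
      (∀ i j, Nonempty (C i j ≃ₗ[K i ⊗[Z] K j] (Fin (g i j) → K i ⊗[Z] K j))) ∧
      (∀ i j, Module.finrank (K i) (C i j) = Module.finrank Z (K j) * g i j) ∧
      ∀ i i' k k', g i k * g i' k' = g i k' * g i' k := by
  have hfin := finite_of_tmul_smul hsmul
  have hart := ht.isArtinianRing_tensor hZ
  have hnt : ∀ i j, Nontrivial (K i ⊗[Z] K j) := fun i j => Module.nontrivial _ (C i j)
  choose g x α hα hx hg using fun i j =>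
    Module.exists_span_range_eq_top_and_finrank_quotient_eq (K i ⊗[Z] K j) (C i j)
  have hli := ht.linearIndependent_generators hZ hsmul x hx α hα hg
  have e := fun i j => (Module.Basis.mk (hli i j) (hx i j).ge).equivFun
  have hdim : ∀ i j, Module.finrank (K i) (C i j) = Module.finrank Z (K j) * g i j := fun i j => by
    have := isScalarTower_of_tmul_smul hsmul i j
    have := free_of_mem_iff hZ j
    have : Nonempty ι := ⟨j⟩
    have : Nontrivial Z := (isField_of_mem_iff hZ).nontrivial
    have : Module.Finite Z (K j) := ht.coordHom_finite hZ j
    rw [((e i j).restrictScalars (K i)).finrank_eq, Module.finrank_pi_fintype]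
    simp [mul_comm]
  have hpos : ∀ i j, 0 < g i j := fun i j => by
    have : 0 < Module.finrank (K i) (C i j) := Module.finrank_pos
    rw [hdim] at this
    exact Nat.pos_of_mul_pos_left this
  refine ⟨g, hpos, fun i j => ⟨e i j⟩, hdim,
    mul_eq_mul_of_forall_fixed (p := fun i j => Module.finrank (K i) (C i j)) (d := d)
      (fun i j => Module.finrank_pos) hpos fun i k => ?_⟩
  have h := ht.sum_finrank_mul_finrank i k
  -- Since `p i k = [K k : Z] * g i k`, cancelling this degree turns `p² = d p` into `p g = d g`.
  have hn : 0 < Module.finrank Z (K k) := by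
    have : 0 < Module.finrank (K k) (C k k) := Module.finrank_pos
    rw [hdim] at this
    exact Nat.pos_of_mul_pos_right this
  refine Nat.eq_of_mul_eq_mul_left hn ?_
  rw [mul_left_comm, ← hdim, ← h, Finset.mul_sum]
  exact Finset.sum_congr rfl fun j _ => by rw [hdim j k]; ring

end Freeness

/-! ### The Peirce decomposition of `P`. -/

section Decomposition

variable {ι : Type u} [DecidableEq ι] (K : ι → Type v) [∀ i, Field (K i)]
  (P : Type w) [AddCommGroup P] [Module (∀ i, K i) P] [Module (∀ i, K i)ᵐᵒᵖ P]
  [SMulCommClass (∀ i, K i) (∀ i, K i)ᵐᵒᵖ P]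

/-- The component `e_i P e_j` as a subgroup of `P`. -/
def peirceComponent (i j : ι) : AddSubgroup P where
  carrier := {x | (Pi.single i 1 : ∀ i, K i) • x = x ∧ op (Pi.single j 1 : ∀ i, K i) • x = x}
  zero_mem' := ⟨smul_zero _, smul_zero _⟩
  add_mem' := fun h h' => ⟨by rw [smul_add, h.1, h'.1], by rw [smul_add, h.2, h'.2]⟩
  neg_mem' := fun h => ⟨by rw [smul_neg, h.1], by rw [smul_neg, h.2]⟩

variable {P} in
theorem single_smul_op_single_smul_mem (i j : ι) (a : K i) (b : K j) (x : P) :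
    (Pi.single i a : ∀ i, K i) • op (Pi.single j b : ∀ i, K i) • x ∈ peirceComponent K P i j := by
  refine ⟨?_, ?_⟩
  · rw [smul_smul, ← Pi.single_mul, one_mul]
  · rw [← smul_comm (Pi.single i a : ∀ i, K i), smul_smul, ← op_mul, ← Pi.single_mul, mul_one]

instance (i j : ι) : Module (K i) (peirceComponent K P i j) where
  smul a x := ⟨(Pi.single i a : ∀ i, K i) • (x : P), by
    have := single_smul_op_single_smul_mem K i j a 1 (x : P)
    rwa [x.2.2] at this⟩
  one_smul x := Subtype.ext x.2.1
  mul_smul a b x := Subtype.ext <| by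
    change (Pi.single i (a * b) : ∀ i, K i) • (x : P) = _
    rw [Pi.single_mul, mul_smul]
    rfl
  smul_zero a := Subtype.ext (smul_zero _)
  smul_add a x y := Subtype.ext (smul_add _ _ _)
  add_smul a b x := Subtype.ext <| by
    change (Pi.single i (a + b) : ∀ i, K i) • (x : P) = _
    rw [Pi.single_add, add_smul]
    rfl
  zero_smul x := Subtype.ext <| by
    change (Pi.single i 0 : ∀ i, K i) • (x : P) = _
    rw [Pi.single_zero, zero_smul]
    rfl

variable {P} in
theorem coe_smul_peirceComponent {i j : ι} (a : K i) (x : peirceComponent K P i j) :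
    ((a • x : peirceComponent K P i j) : P) = (Pi.single i a : ∀ i, K i) • (x : P) := rfl

/-- The right action of `K j` on `e_i P e_j`. -/
def peirceRightAction (i j : ι) : K j →+* Module.End (K i) (peirceComponent K P i j) where
  toFun b :=
    { toFun := fun x => ⟨op (Pi.single j b : ∀ i, K i) • (x : P), by
        have := single_smul_op_single_smul_mem K i j 1 b (x : P)
        rwa [smul_comm, x.2.1] at this⟩
      map_add' := fun x y => Subtype.ext (smul_add _ _ _)
      map_smul' := fun a x => Subtype.ext (smul_comm _ _ _).symm }
  map_one' := LinearMap.ext fun x => Subtype.ext x.2.2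
  map_mul' a b := LinearMap.ext fun x => Subtype.ext <| by
    change op (Pi.single j (a * b) : ∀ i, K i) • (x : P) = _
    rw [mul_comm, Pi.single_mul, op_mul, mul_smul]
    rfl
  map_zero' := LinearMap.ext fun x => Subtype.ext <| by
    change op (Pi.single j 0 : ∀ i, K i) • (x : P) = _
    rw [Pi.single_zero, op_zero, zero_smul]
    rfl
  map_add' a b := LinearMap.ext fun x => Subtype.ext <| by
    change op (Pi.single j (a + b) : ∀ i, K i) • (x : P) = _
    rw [Pi.single_add, op_add, add_smul]
    rfl

variable {P} in
theorem coe_peirceRightAction {i j : ι} (b : K j) (x : peirceComponent K P i j) :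
    ((peirceRightAction K P i j b x : peirceComponent K P i j) : P) =
      op (Pi.single j b : ∀ i, K i) • (x : P) := rfl

/-- The projection `x ↦ e_i x e_j`. -/
def peirceProj (i j : ι) : P →+ peirceComponent K P i j where
  toFun x := ⟨_, single_smul_op_single_smul_mem K i j 1 1 x⟩
  map_zero' := Subtype.ext (by simp)
  map_add' x y := Subtype.ext (by simp [smul_add])

variable {P} in
theorem coe_peirceProj (i j : ι) (x : P) : (peirceProj K P i j x : P) =
    (Pi.single i 1 : ∀ i, K i) • op (Pi.single j 1 : ∀ i, K i) • x := rfl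

variable {K P}

theorem peirceProj_smul (i j : ι) (l : ∀ i, K i) (x : P) :
    peirceProj K P i j (l • x) = l i • peirceProj K P i j x := Subtype.ext <| by
  rw [coe_smul_peirceComponent, coe_peirceProj, coe_peirceProj, ← smul_comm l, smul_smul, smul_smul,
    ← Pi.single_mul, ← Pi.single_mul_left, one_mul, mul_one]

theorem peirceProj_op_smul (i j : ι) (l : ∀ i, K i) (x : P) :
    peirceProj K P i j (op l • x) = peirceRightAction K P i j (l j) (peirceProj K P i j x) :=
  Subtype.ext <| by
  rw [coe_peirceRightAction, coe_peirceProj, coe_peirceProj,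
    ← smul_comm (Pi.single i (1 : K i) : ∀ i, K i), smul_smul (op _), smul_smul (op _),
    ← op_mul, ← op_mul, ← Pi.single_mul, ← Pi.single_mul_right, one_mul, mul_one]

theorem peirceProj_coe {i j : ι} (x : peirceComponent K P i j) : peirceProj K P i j x = x :=
  Subtype.ext <| by rw [coe_peirceProj, x.2.2, x.2.1]

theorem peirceProj_coe_of_ne_left {i i' j' : ι} (h : i' ≠ i) (j : ι)
    (x : peirceComponent K P i' j') : peirceProj K P i j x = 0 := by
  rw [← x.2.1, peirceProj_smul, Pi.single_eq_of_ne' h, zero_smul]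

theorem peirceProj_coe_of_ne_right {j j' i' : ι} (h : j' ≠ j) (i : ι)
    (x : peirceComponent K P i' j') : peirceProj K P i j x = 0 := by
  rw [← x.2.2, peirceProj_op_smul, Pi.single_eq_of_ne' h, map_zero, LinearMap.zero_apply]

theorem smul_eq_of_mem {i j : ι} (l : ∀ i, K i) (x : peirceComponent K P i j) :
    l • (x : P) = (l i • x : peirceComponent K P i j) := by
  conv_lhs => rw [← x.2.1]
  rw [coe_smul_peirceComponent, smul_smul, ← Pi.single_mul_right, mul_one]

theorem op_smul_eq_of_mem {i j : ι} (l : ∀ i, K i) (x : peirceComponent K P i j) :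
    op l • (x : P) = (peirceRightAction K P i j (l j) x : peirceComponent K P i j) := by
  conv_lhs => rw [← x.2.2]
  rw [coe_peirceRightAction, smul_smul, ← op_mul, ← Pi.single_mul_left, one_mul]

variable [Fintype ι]

theorem sum_op_single_smul (x : P) : ∑ j, op (Pi.single j 1 : ∀ i, K i) • x = x := by
  rw [← Finset.sum_smul, ← Finset.op_sum, Finset.univ_sum_single fun i => (1 : K i)]
  exact one_smul _ x

theorem sum_single_smul (x : P) : ∑ j, (Pi.single j 1 : ∀ i, K i) • x = x := by
  rw [← Finset.sum_smul, Finset.univ_sum_single fun i => (1 : K i)]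
  exact one_smul _ x

theorem sum_peirceProj (x : P) : ∑ i, ∑ j, (peirceProj K P i j x : P) = x := by
  simp only [coe_peirceProj, ← Finset.smul_sum, sum_op_single_smul, sum_single_smul]

variable (K P) in
/-- The Peirce decomposition `P ≃ ⨁ e_i P e_j`. -/
def peirceEquiv : P ≃+ ∀ i j, peirceComponent K P i j where
  toFun x i j := peirceProj K P i j x
  invFun y := ∑ i, ∑ j, (y i j : P)
  left_inv := sum_peirceProj
  right_inv y := by
    funext i j
    simp only [map_sum]
    rw [Fintype.sum_eq_single i fun i' h => Finset.sum_eq_zero fun j' _ =>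
        peirceProj_coe_of_ne_left h j _,
      Fintype.sum_eq_single j fun j' h => peirceProj_coe_of_ne_right h i _, peirceProj_coe]
  map_add' x y := by funext i j; exact map_add _ _ _

theorem peirceEquiv_apply (x : P) (i j : ι) : peirceEquiv K P x i j = peirceProj K P i j x := rfl

theorem mem_bimoduleCenter_iff (z : ∀ i, K i) : z ∈ bimoduleCenter (∀ i, K i) P ↔
    ∀ i j (x : peirceComponent K P i j), z i • x = peirceRightAction K P i j (z j) x := by
  constructor
  · intro hz i j x
    rw [← Subtype.coe_inj, ← smul_eq_of_mem, ← op_smul_eq_of_mem]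
    exact hz x
  · intro h x
    refine (peirceEquiv K P).injective (funext fun i => funext fun j => ?_)
    rw [peirceEquiv_apply, peirceEquiv_apply, peirceProj_smul, peirceProj_op_smul, h]

end Decomposition

/-! ### From `P ⊗ P ≅ P ^ d` to `IsTensorPower`. -/

section TensorPower

variable {ι : Type u} [DecidableEq ι] {K : ι → Type v} [∀ i, Field (K i)]
  {P : Type w} [AddCommGroup P] [Module (∀ i, K i) P] [Module (∀ i, K i)ᵐᵒᵖ P]
  [SMulCommClass (∀ i, K i) (∀ i, K i)ᵐᵒᵖ P]

theorem BimoduleTensor.op_smul_tmul {A : Type u} [Ring A] {P : Type v} [AddCommGroup P] [Module A P]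
    [Module Aᵐᵒᵖ P] [SMulCommClass A Aᵐᵒᵖ P] {Q : Type w} [AddCommGroup Q] [Module A Q]
    [Module Aᵐᵒᵖ Q] [SMulCommClass A Aᵐᵒᵖ Q] (a : A) (x : P) (y : Q) :
    tmul A (op a • x) y = tmul A x (a • y) := by
  have h : (op a • x) ⊗ₜ[ℤ] y - x ⊗ₜ[ℤ] (a • y) ∈ relations A P Q :=
    AddSubgroup.subset_closure ⟨x, a, y, rfl⟩
  exact sub_eq_zero.1 ((QuotientAddGroup.eq_zero_iff _).2 h)

theorem BimoduleTensor.addSubgroup_eq_top {A : Type u} [Ring A] {P : Type v} [AddCommGroup P]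
    [Module A P] [Module Aᵐᵒᵖ P] [SMulCommClass A Aᵐᵒᵖ P] {Q : Type w} [AddCommGroup Q] [Module A Q]
    [Module Aᵐᵒᵖ Q] [SMulCommClass A Aᵐᵒᵖ Q] (N : AddSubgroup (BimoduleTensor A P Q))
    (h : ∀ x y, tmul A x y ∈ N) : N = ⊤ := by
  rw [eq_top_iff]
  rintro u -
  obtain ⟨u, rfl⟩ := QuotientAddGroup.mk'_surjective _ u
  induction u using TensorProduct.induction_on with
  | zero => rw [map_zero]; exact N.zero_mem
  | tmul x y => exact h x y
  | add s t hs ht => rw [map_add]; exact N.add_mem hs ht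

theorem exists_bimoduleTensor_lift [Fintype ι] (i k : ι) {G : Type*} [AddCommGroup G]
    (f : ∀ j, peirceComponent K P i j →+ peirceComponent K P j k →+ G)
    (hf : ∀ j c y x, f j (peirceRightAction K P i j c y) x = f j y (c • x)) :
    ∃ F : BimoduleTensor (∀ i, K i) P P →+ G,
      ∀ j (y : peirceComponent K P i j) (x : peirceComponent K P j k),
        F (BimoduleTensor.tmul (∀ i, K i) (y : P) (x : P)) = f j y x := by
  let B : P →+ P →+ G := ∑ j, ((f j).comp (peirceProj K P i j)).compl₂ (peirceProj K P j k)
  have hB : ∀ y x, B y x = ∑ j, f j (peirceProj K P i j y) (peirceProj K P j k x) := fun y x => by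
    simp only [B, AddMonoidHom.finsetSum_apply]
    rfl
  let F₀ : P ⊗[ℤ] P →+ G := TensorProduct.liftAddHom B fun n y x => by simp
  have hF₀ : BimoduleTensor.relations (∀ i, K i) P P ≤ F₀.ker := by
    refine (AddSubgroup.closure_le _).2 ?_
    rintro _ ⟨y, a, x, rfl⟩
    change F₀ _ = 0
    rw [map_sub, TensorProduct.liftAddHom_tmul, TensorProduct.liftAddHom_tmul, hB, hB, sub_eq_zero]
    exact Finset.sum_congr rfl fun j _ => by rw [peirceProj_op_smul, peirceProj_smul, hf]
  refine ⟨QuotientAddGroup.lift _ F₀ hF₀, fun j y x => ?_⟩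
  change B y x = _
  rw [hB, Fintype.sum_eq_single j fun j' h => by
    rw [peirceProj_coe_of_ne_right h.symm, map_zero, AddMonoidHom.zero_apply],
    peirceProj_coe, peirceProj_coe]

section

variable {d : ℕ} (e : BimoduleTensor (∀ i, K i) P P ≃ₗ[∀ i, K i] (Fin d → P))
  (he : ∀ (a : ∀ i, K i) x, e (op a • x) = op a • e x)

/-- The products `e_i P e_j × e_j P e_k → (e_i P e_k) ^ d` defined by `P ⊗ P ≃ P ^ d`. -/
def peirceMul (i j k : ι) :
    peirceComponent K P i j →+ peirceComponent K P j k →+ (Fin d → peirceComponent K P i k) :=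
  AddMonoidHom.mk' (fun y => AddMonoidHom.mk'
    (fun x s => peirceProj K P i k (e (BimoduleTensor.tmul _ (y : P) (x : P)) s))
    fun x x' => by
      funext s
      rw [AddSubgroup.coe_add, BimoduleTensor.tmul_add, map_add, Pi.add_apply, map_add]
      rfl)
    fun y y' => by
      ext x s : 2
      change peirceProj K P i k (e (BimoduleTensor.tmul _ ((y + y' : _) : P) (x : P)) s) = _
      rw [AddSubgroup.coe_add, BimoduleTensor.add_tmul, map_add, Pi.add_apply, map_add]
      rfl

include he in
-- The projection in the definition changes nothing: `e` respects both actions, and the tensor is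
-- already fixed by `e_i` and `e_k`.
theorem coe_peirceMul (i j k : ι) (y : peirceComponent K P i j) (x : peirceComponent K P j k)
    (s : Fin d) : (peirceMul e i j k y x s : P) = e (BimoduleTensor.tmul _ (y : P) (x : P)) s := by
  change (peirceProj K P i k (e (BimoduleTensor.tmul _ (y : P) (x : P)) s) : P) = _
  rw [coe_peirceProj]
  have h : e ((Pi.single i 1 : ∀ i, K i) • op (Pi.single k 1 : ∀ i, K i) •
      BimoduleTensor.tmul _ (y : P) (x : P)) s = (Pi.single i 1 : ∀ i, K i) •
        op (Pi.single k 1 : ∀ i, K i) • e (BimoduleTensor.tmul _ (y : P) (x : P)) s := by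
    rw [map_smul, he]
    rfl
  refine h.symm.trans ?_
  change e (BimoduleTensor.tmul _ ((Pi.single i 1 : ∀ i, K i) • (y : P))
    (op (Pi.single k 1 : ∀ i, K i) • (x : P))) s = _
  rw [y.2.1, x.2.2]

include he in
theorem exists_peirceMul_lift [Fintype ι] (i k : ι) {G : Type*} [AddCommGroup G]
    (f : ∀ j, peirceComponent K P i j →+ peirceComponent K P j k →+ G)
    (hf : ∀ j c y x, f j (peirceRightAction K P i j c y) x = f j y (c • x)) :
    ∃ F : (Fin d → peirceComponent K P i k) →+ G,
      ∀ j y x, F (peirceMul e i j k y x) = f j y x := by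
  obtain ⟨F, hF⟩ := exists_bimoduleTensor_lift i k f hf
  refine ⟨(F.comp e.symm.toLinearMap.toAddMonoidHom).comp
    ((peirceComponent K P i k).subtype.compLeft (Fin d)), fun j y x => ?_⟩
  rw [← hF]
  change F (e.symm fun s => (peirceMul e i j k y x s : P)) = _
  simp only [coe_peirceMul e he]
  exact congrArg F (e.symm_apply_apply _)

include he in
theorem exists_peirceMul_lift_single [Fintype ι] (i j k : ι) {G : Type*} [AddCommGroup G]
    (f : peirceComponent K P i j →+ peirceComponent K P j k →+ G)
    (hf : ∀ c y x, f (peirceRightAction K P i j c y) x = f y (c • x)) :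
    ∃ F : (Fin d → peirceComponent K P i k) →+ G,
      (∀ y x, F (peirceMul e i j k y x) = f y x) ∧
        ∀ j', j' ≠ j → ∀ y x, F (peirceMul e i j' k y x) = 0 := by
  obtain ⟨F, hF⟩ := exists_peirceMul_lift e he i k
    (Pi.single (M := fun j => peirceComponent K P i j →+ peirceComponent K P j k →+ G) j f)
      fun j' c y x => by
        by_cases hj : j' = j
        · subst hj
          rw [Pi.single_eq_same, hf]
        · rw [Pi.single_eq_of_ne hj]
          rfl
  refine ⟨F, fun y x => by rw [hF, Pi.single_eq_same], fun j' hj y x => ?_⟩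
  rw [hF, Pi.single_eq_of_ne hj]
  rfl

/-- Inserts `1 = ∑ e_j` between the factors and uses `e_j² = e_j` to place `e_j` on both sides. -/
theorem BimoduleTensor.single_smul_tmul_op_single_smul [Fintype ι] (i k : ι) (y x : P) :
    tmul (∀ i, K i) ((Pi.single i 1 : ∀ i, K i) • y) (op (Pi.single k 1 : ∀ i, K i) • x) =
      ∑ j, tmul (∀ i, K i) (peirceProj K P i j y : P) (peirceProj K P j k x : P) := by
  have h := map_sum (AddMonoidHom.mk' (tmul (∀ i, K i) ((Pi.single i 1 : ∀ i, K i) • y))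
    (tmul_add _ _ _ _)) (fun j => (Pi.single j 1 : ∀ i, K i) • op (Pi.single k 1 : ∀ i, K i) • x)
    Finset.univ
  rw [sum_single_smul] at h
  refine h.trans (Finset.sum_congr rfl fun j _ => ?_)
  rw [coe_peirceProj, coe_peirceProj,
    smul_comm (Pi.single i (1 : K i) : ∀ i, K i) (op (Pi.single j 1 : ∀ i, K i)) y, op_smul_tmul,
    smul_smul, ← Pi.single_mul, one_mul]
  rfl

include he in
theorem peirceProj_apply_tmul [Fintype ι] (i k : ι) (y x : P) :
    (fun s => peirceProj K P i k (e (BimoduleTensor.tmul _ y x) s)) =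
      ∑ j, peirceMul e i j k (peirceProj K P i j y) (peirceProj K P j k x) := by
  funext s
  refine Subtype.ext ?_
  rw [Finset.sum_apply, AddSubgroup.val_finsetSum]
  simp only [coe_peirceMul e he]
  rw [← Finset.sum_apply, ← map_sum, ← BimoduleTensor.single_smul_tmul_op_single_smul,
    coe_peirceProj]
  have h : e ((Pi.single i 1 : ∀ i, K i) • op (Pi.single k 1 : ∀ i, K i) •
      BimoduleTensor.tmul _ y x) s = (Pi.single i 1 : ∀ i, K i) •
        op (Pi.single k 1 : ∀ i, K i) • e (BimoduleTensor.tmul _ y x) s := by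
    rw [map_smul, he]
    rfl
  exact h.symm

include he in
theorem addSubgroup_eq_top_of_peirceMul_mem [Fintype ι] (i k : ι)
    (N : AddSubgroup (Fin d → peirceComponent K P i k))
    (hN : ∀ j y x, peirceMul e i j k y x ∈ N) : N = ⊤ := by
  let Q : BimoduleTensor (∀ i, K i) P P →+ (Fin d → peirceComponent K P i k) :=
    ((peirceProj K P i k).compLeft (Fin d)).comp e.toLinearMap.toAddMonoidHom
  have hQ : N.comap Q = ⊤ := BimoduleTensor.addSubgroup_eq_top _ fun y x => by
    rw [AddSubgroup.mem_comap]
    change (fun s => peirceProj K P i k (e (BimoduleTensor.tmul _ y x) s)) ∈ N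
    rw [peirceProj_apply_tmul e he]
    exact N.sum_mem fun j _ => hN j _ _
  refine top_le_iff.1 fun m _ => ?_
  have hm : Q (e.symm fun s => (m s : P)) = m := by
    change (fun s => peirceProj K P i k (e (e.symm fun s => (m s : P)) s)) = m
    rw [e.apply_symm_apply]
    exact funext fun s => peirceProj_coe _
  rw [← hm]
  exact hQ.ge (AddSubgroup.mem_top _)

include he in
theorem smul_left_peirceMul (i j k : ι) (a : K i) (y : peirceComponent K P i j)
    (x : peirceComponent K P j k) : peirceMul e i j k (a • y) x = a • peirceMul e i j k y x := by
  funext s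
  refine Subtype.ext ?_
  rw [Pi.smul_apply, coe_smul_peirceComponent, coe_peirceMul e he, coe_peirceMul e he]
  exact congrFun (map_smul e (Pi.single i a : ∀ i, K i)
    (BimoduleTensor.tmul _ (y : P) (x : P))) s

include he in
theorem isTensorPower_peirceMul [Fintype ι] :
    IsTensorPower (peirceRightAction K P) d (peirceMul e) where
  smul_left := smul_left_peirceMul e he
  smul_right i j k b y x s := by
    refine Subtype.ext ?_
    rw [coe_peirceRightAction, coe_peirceMul e he, coe_peirceMul e he]
    exact congrFun (he (Pi.single k b) (BimoduleTensor.tmul _ (y : P) (x : P))) s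
  balanced i j k c y x := by
    funext s
    refine Subtype.ext ?_
    rw [coe_peirceMul e he, coe_peirceMul e he, coe_peirceRightAction,
      BimoduleTensor.op_smul_tmul, coe_smul_peirceComponent]
  eq_top := addSubgroup_eq_top_of_peirceMul_mem e he
  functional i j k φ ψ := by
    obtain ⟨F, hF, hF'⟩ := exists_peirceMul_lift_single e he i j k
      (AddMonoidHom.mk' (fun y => AddMonoidHom.mk' (fun x => φ (peirceRightAction K P i j (ψ x) y))
        fun x x' => by rw [map_add, map_add, LinearMap.add_apply, map_add])
        fun y y' => by
          ext x : 1
          change φ (peirceRightAction K P i j (ψ x) (y + y')) = φ _ + φ _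
          rw [map_add, map_add])
      fun c y x => by
        change φ (peirceRightAction K P i j (ψ x) (peirceRightAction K P i j c y)) =
          φ (peirceRightAction K P i j (ψ (c • x)) y)
        rw [map_smul, smul_eq_mul, mul_comm, map_mul, Module.End.mul_apply]
    refine ⟨{ F with
      map_smul' := fun a m => ?_ }, hF, hF'⟩
    -- The lift is only additive a priori; the elements on which it commutes with `a` form a
    -- subgroup containing all products.
    have hN := addSubgroup_eq_top_of_peirceMul_mem e he i k
      { carrier := {m | F (a • m) = a • F m}
        zero_mem' := by simp
        add_mem' := fun {m m'} h h' => by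
          change F (a • (m + m')) = a • F (m + m')
          rw [smul_add, map_add, map_add, smul_add, h, h']
        neg_mem' := fun {m} h => by
          change F (a • -m) = a • F (-m)
          rw [smul_neg, map_neg, map_neg, smul_neg, h] } fun j' y x => by
      change F (a • peirceMul e i j' k y x) = a • F (peirceMul e i j' k y x)
      rw [← smul_left_peirceMul e he]
      by_cases hj : j' = j
      · subst hj
        rw [hF, hF]
        change φ (peirceRightAction K P i j' (ψ x) (a • y)) =
          a • φ (peirceRightAction K P i j' (ψ x) y)
        rw [map_smul, map_smul]
      · rw [hF' j' hj, hF' j' hj, smul_zero]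
    exact hN.ge (AddSubgroup.mem_top m)
  contraction i j k l hl := by
    obtain ⟨F, hF, -⟩ := exists_peirceMul_lift_single e he i j k
      (AddMonoidHom.mk' (fun y => DistribSMul.toAddMonoidHom (peirceComponent K P j k) (l y))
        fun y y' => by
          ext x : 1
          change l (y + y') • x = l y • x + l y' • x
          rw [map_add, add_smul])
      fun c y x => by
        change l (peirceRightAction K P i j c y) • x = l y • c • x
        rw [hl, mul_comm, mul_smul]
    exact ⟨F, hF⟩

end

end TensorPower

/-! ### Rows, columns and connectedness. -/

section

variable {ι : Type u} [DecidableEq ι] {K : ι → Type v} [∀ i, Field (K i)]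

/-- A semilinear isomorphism of products of `K i`-modules is a product of isomorphisms. -/
noncomputable def piComponentLinearEquiv {A B : ι → Type*} [∀ i, AddCommGroup (A i)] [∀ i, Module (K i) (A i)]
    [∀ i, AddCommGroup (B i)] [∀ i, Module (K i) (B i)] (f : (∀ i, A i) ≃+ ∀ i, B i)
    (hf : ∀ (l : ∀ i, K i) y i, f (fun i => l i • y i) i = l i • f y i) (i : ι) :
    A i ≃ₗ[K i] B i :=
  -- Multiplication by the idempotent `e_i` shows that `f` preserves support at `i`.
  have hsupp : ∀ a, f (Pi.single i a) = Pi.single i (f (Pi.single i a) i) := fun a => by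
    have h : (fun j => (Pi.single i 1 : ∀ i, K i) j • (Pi.single i a : ∀ i, A i) j) =
        Pi.single i a := by
      funext j
      by_cases hj : j = i
      · subst hj; simp
      · simp [Pi.single_eq_of_ne hj]
    funext j
    by_cases hj : j = i
    · subst hj; simp
    · rw [Pi.single_eq_of_ne hj, ← h, hf, Pi.single_eq_of_ne hj, zero_smul]
  have hsurj : ∀ b, ∃ a, f (Pi.single i a) i = b := fun b => by
    refine ⟨f.symm (Pi.single i b) i, ?_⟩
    have h : (fun j => (Pi.single i 1 : ∀ i, K i) j • f.symm (Pi.single i b) j) =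
        Pi.single i (f.symm (Pi.single i b) i) := by
      funext j
      by_cases hj : j = i
      · subst hj; simp
      · simp [Pi.single_eq_of_ne hj]
    rw [← h, hf]
    simp
  LinearEquiv.ofBijective
    { toFun := fun a => f (Pi.single i a) i
      map_add' := fun a a' => by rw [Pi.single_add, map_add, Pi.add_apply]
      map_smul' := fun c a => by
        have h : (fun j => (Pi.single i c : ∀ i, K i) j • (Pi.single i a : ∀ i, A i) j) =
            Pi.single i (c • a) := by
          funext j
          by_cases hj : j = i
          · subst hj; simp
          · simp [Pi.single_eq_of_ne hj]
        rw [RingHom.id_apply, ← h, hf, Pi.single_eq_same] }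
    ⟨fun a a' h => by
      have h' : f (Pi.single i a) = f (Pi.single i a') := by
        rw [hsupp a, hsupp a']
        exact congrArg _ h
      exact Pi.single_injective i (f.injective h'), hsurj⟩

section Dimension

variable {P : Type w} [AddCommGroup P] [Module (∀ i, K i) P] [Module (∀ i, K i)ᵐᵒᵖ P]
  [SMulCommClass (∀ i, K i) (∀ i, K i)ᵐᵒᵖ P] [Fintype ι]

/-- A description of `P` as a left module yields one of its rows `e_i P = ⨁ e_i P e_j`. -/
noncomputable def peirceRowEquiv {B : ι → Type*} [∀ i, AddCommGroup (B i)] [∀ i, Module (K i) (B i)]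
    (e : P ≃+ ∀ i, B i) (he : ∀ (l : ∀ i, K i) x i, e (l • x) i = l i • e x i) (i : ι) :
    (∀ j, peirceComponent K P i j) ≃ₗ[K i] B i :=
  piComponentLinearEquiv ((peirceEquiv K P).symm.trans e) (fun l y i => by
    have h : (peirceEquiv K P).symm (fun i => l i • y i) = l • (peirceEquiv K P).symm y := by
      rw [AddEquiv.symm_apply_eq]
      funext i j
      rw [peirceEquiv_apply, peirceProj_smul, ← peirceEquiv_apply, AddEquiv.apply_symm_apply]
      rfl
    rw [AddEquiv.trans_apply, h, he]
    rfl) i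

theorem nontrivial_of_row {p : ι → ℕ} (hp : ∀ i, 0 < p i) (e : P ≃+ ∀ i, Fin (p i) → K i)
    (he : ∀ (l : ∀ i, K i) (x : P) (i : ι) (k : Fin (p i)), e (l • x) i k = l i * e x i k) (i : ι) :
    ∃ j, Nontrivial (peirceComponent K P i j) := by
  by_contra! h
  have : Nonempty (Fin (p i)) := ⟨⟨0, hp i⟩⟩
  have := (peirceRowEquiv e (fun l x i => funext fun k => he l x i k) i).symm.subsingleton
  exact not_subsingleton _ this

theorem nontrivial_of_column {q : ι → ℕ} (hq : ∀ i, 0 < q i) (e : P ≃+ ∀ i, Fin (q i) → K i)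
    (he : ∀ (l : ∀ i, K i) (x : P) (i : ι) (k : Fin (q i)), e (op l • x) i k = e x i k * l i)
    (j : ι) : ∃ i, Nontrivial (peirceComponent K P i j) := by
  by_contra! h
  -- A nonzero vector supported at `j` corresponds to an element of `P e_j`, which would vanish if
  -- all `e_i P e_j` did.
  let y : ∀ i, Fin (q i) → K i := Pi.single j 1
  have hy : op (Pi.single j 1 : ∀ i, K i) • e.symm y = e.symm y := by
    rw [AddEquiv.eq_symm_apply]
    funext i k
    rw [he, AddEquiv.apply_symm_apply]
    by_cases hi : i = j
    · subst hi; simp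
    · simp [y, Pi.single_eq_of_ne hi]
  have h0 : e.symm y = 0 := by
    refine (peirceEquiv K P).injective (funext fun i => funext fun j' => ?_)
    rw [map_zero, ← hy, peirceEquiv_apply, peirceProj_op_smul]
    by_cases hj : j' = j
    · subst hj
      exact Subsingleton.elim _ _
    · rw [Pi.single_eq_of_ne hj, map_zero]
      rfl
  have : y j ⟨0, hq j⟩ = 0 := by
    rw [(AddEquiv.map_eq_zero_iff e.symm).1 h0]
    rfl
  simp [y] at this

theorem finite_peirceComponent {p : ι → ℕ} (e : P ≃+ ∀ i, Fin (p i) → K i)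
    (he : ∀ (l : ∀ i, K i) (x : P) (i : ι) (k : Fin (p i)), e (l • x) i k = l i * e x i k)
    (i j : ι) : Module.Finite (K i) (peirceComponent K P i j) := by
  have := Module.Finite.equiv (peirceRowEquiv e (fun l x i => funext fun k => he l x i k) i).symm
  exact Module.Finite.of_surjective (LinearMap.proj (R := K i)
    (φ := fun j => peirceComponent K P i j) j) (Function.surjective_eval j)

theorem nontrivial_peirceComponent_of_connected (hconn : IsConnectedBimodule K P)
    [∀ i j, Module.Finite (K i) (peirceComponent K P i j)] {d : ℕ}
    (hrow : ∀ i, ∃ j, Nontrivial (peirceComponent K P i j))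
    (hcol : ∀ j, ∃ i, Nontrivial (peirceComponent K P i j))
    (hsq : ∀ i k, ∑ j, Module.finrank (K i) (peirceComponent K P i j) *
      Module.finrank (K j) (peirceComponent K P j k) =
        d * Module.finrank (K i) (peirceComponent K P i k)) (i j : ι) :
    Nontrivial (peirceComponent K P i j) := by
  let p : ι → ι → ℕ := fun i j => Module.finrank (K i) (peirceComponent K P i j)
  have hp : ∀ i j, 0 < p i j ↔ Nontrivial (peirceComponent K P i j) := fun i j =>
    Module.finrank_pos_iff
  have hrow' : ∀ i, ∃ j, 0 < p i j := fun i => (hrow i).imp fun j => (hp i j).2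
  have hcol' : ∀ j, ∃ i, 0 < p i j := fun j => (hcol j).imp fun i => (hp i j).2
  have hsymm : ∀ {i j}, 0 < p i j → 0 < p j i := pos_symm_of_sq_eq_mul hsq hrow' hcol'
  have htrans : ∀ {i j k}, 0 < p i j → 0 < p j k → 0 < p i k := pos_trans_of_sq_eq_mul hsq
  have hrefl : ∀ i, 0 < p i i := fun i => by
    obtain ⟨j, hj⟩ := hrow' i
    exact htrans hj (hsymm hj)
  have hedge : ∀ {i j}, incidenceEdge K P i j → 0 < p j i := by
    rintro i j ⟨_, ⟨x, rfl⟩, hx⟩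
    refine (hp j i).2 ⟨⟨peirceProj K P j i x, 0, fun h => hx ?_⟩⟩
    rw [← coe_peirceProj, h]
    rfl
  rw [← hp]
  -- The support of `p` is an equivalence relation containing the edges in either orientation, so it
  -- propagates along a walk.
  obtain ⟨W⟩ := hconn.preconnected i j
  induction W with
  | nil => exact hrefl _
  | cons h _ ih =>
    refine htrans ?_ ih
    rw [SimpleGraph.fromRel_adj] at h
    exact h.2.elim (fun h => hsymm (hedge h)) hedge

end Dimension

end

/-! ### Decomposition of `L ⊗[Z] L`. -/

section

theorem exists_tensorSquareBimodule_addEquiv {ι : Type u} [Finite ι] {L : Type w} [CommRing L]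
    (Z : Subring L) (K : ι → Type v) [∀ i, CommRing (K i)] [∀ i, Algebra Z (K i)]
    (e : L ≃+* ∀ i, K i) (he : ∀ (z : Z) i, e z i = algebraMap Z (K i) z) :
    ∃ Θ : TensorSquareBimodule Z ≃+ ∀ i j, K i ⊗[Z] K j,
      (∀ (l : L) u i j, Θ (l • u) i j = (e l i ⊗ₜ 1) * Θ u i j) ∧
        ∀ (l : L) u i j, Θ (op l • u) i j = (1 ⊗ₜ e l j) * Θ u i j := by
  classical
  have : Fintype ι := Fintype.ofFinite ι
  let e' : L ≃ₗ[Z] ∀ i, K i :=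
    { e with
      map_smul' := fun z a => by
        funext i
        change e (z • a) i = z • e a i
        rw [Algebra.smul_def, map_mul, Pi.mul_apply, Algebra.smul_def]
        exact congrArg (· * e a i) (he z i) }
  let Θ := (TensorProduct.congr e' e').trans <| (TensorProduct.piRight Z Z (∀ i, K i) K).trans <|
    LinearEquiv.piCongrRight fun j => (TensorProduct.comm Z (∀ i, K i) (K j)).trans <|
      (TensorProduct.piRight Z Z (K j) K).trans <|
        LinearEquiv.piCongrRight fun i => TensorProduct.comm Z (K j) (K i)
  -- Splitting the right factor first puts its index first; the two indices are exchanged here.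
  let Θ' : L ⊗[Z] L ≃+ ∀ i j, K i ⊗[Z] K j :=
    { toFun := fun u i j => Θ u j i
      invFun := fun y => Θ.symm fun j i => y i j
      left_inv := fun u => Θ.symm_apply_apply u
      right_inv := fun y => by
        funext i j
        exact congrFun (congrFun (Θ.apply_symm_apply fun j i => y i j) j) i
      map_add' := fun u v => by
        funext i j
        exact congrFun (congrFun (map_add Θ u v) j) i }
  have hΘ : ∀ a b i j, Θ' (a ⊗ₜ b) i j = e a i ⊗ₜ e b j := fun a b i j => rfl
  have hmul : ∀ l l' u i j, Θ' ((l ⊗ₜ l') * u) i j = (e l i ⊗ₜ[Z] e l' j) * Θ' u i j := by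
    intro l l' u i j
    induction u using TensorProduct.induction_on with
    | zero => rw [mul_zero, map_zero, Pi.zero_apply, Pi.zero_apply, mul_zero]
    | tmul c c' =>
      rw [Algebra.TensorProduct.tmul_mul_tmul, hΘ, hΘ, Algebra.TensorProduct.tmul_mul_tmul,
        map_mul, map_mul]
      rfl
    | add u v hu hv => rw [mul_add, map_add, map_add]; simp only [Pi.add_apply, hu, hv, mul_add]
  refine ⟨Θ', fun l u i j => ?_, fun l u i j => ?_⟩
  · have := hmul l 1 u i j
    rw [map_one, Pi.one_apply] at this
    exact this
  · have := hmul 1 l u i j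
    rw [map_one, Pi.one_apply] at this
    exact this

end

/-! ### Assembling the components into bimodule isomorphisms. -/

section Conclusion

attribute [local instance] coordAlgebra

variable {ι : Type u} [DecidableEq ι] {K : ι → Type v} [∀ i, Field (K i)]
  {P : Type w} [AddCommGroup P] [Module (∀ i, K i) P] [Module (∀ i, K i)ᵐᵒᵖ P]
  [SMulCommClass (∀ i, K i) (∀ i, K i)ᵐᵒᵖ P] [Fintype ι]
  {Z : Subring (∀ i, K i)} [∀ i j, Module (K i ⊗[Z] K j) (peirceComponent K P i j)]
  (hsmul : ∀ i j (a : K i) (b : K j) (x : peirceComponent K P i j),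
    (a ⊗ₜ[Z] b) • x = a • peirceRightAction K P i j b x)

include hsmul

theorem tmul_one_smul (i j : ι) (a : K i) (x : peirceComponent K P i j) :
    (a ⊗ₜ[Z] (1 : K j)) • x = a • x := by rw [hsmul, map_one, Module.End.one_apply]

theorem one_tmul_smul (i j : ι) (b : K j) (x : peirceComponent K P i j) :
    ((1 : K i) ⊗ₜ[Z] b) • x = peirceRightAction K P i j b x := by rw [hsmul, one_smul]

theorem bimoduleIso_blockBimodule (a r : ι → ℕ)
    (e : ∀ i j, peirceComponent K P i j ≃ₗ[K i ⊗[Z] K j] (Fin (a i * r j) → K i ⊗[Z] K j)) :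
    BimoduleIso (∀ i, K i) P (BlockBimodule Z a r) := by
  let E : P ≃+ BlockRing Z a r := (peirceEquiv K P).trans <|
    AddEquiv.piCongrRight fun i => AddEquiv.piCongrRight fun j => (e i j).toAddEquiv
  have hE : ∀ x i j, E x i j = e i j (peirceProj K P i j x) := fun _ _ _ => rfl
  refine ⟨{ toFun := fun x => (E x : BlockRing Z a r)
            invFun := fun y => E.symm (y : BlockRing Z a r)
            left_inv := E.left_inv
            right_inv := E.right_inv
            map_add' := fun x y => E.map_add x y
            map_smul' := fun l x => ?_ }, fun l x => ?_⟩
  · funext i j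
    change E (l • x) i j = (l i ⊗ₜ[Z] (1 : K j)) • E x i j
    rw [hE, hE, peirceProj_smul, ← tmul_one_smul hsmul, map_smul]
  · funext i j
    change E (op l • x) i j = ((1 : K i) ⊗ₜ[Z] l j) • E x i j
    rw [hE, hE, peirceProj_op_smul, ← one_tmul_smul hsmul, map_smul]

theorem bimoduleIso_tensorSquareBimodule (m : ℕ)
    (e : ∀ i j, peirceComponent K P i j ≃ₗ[K i ⊗[Z] K j] (Fin m → K i ⊗[Z] K j)) :
    BimoduleIso (∀ i, K i) P (Fin m → TensorSquareBimodule Z) := by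
  obtain ⟨Θ, hl, hr⟩ :=
    exists_tensorSquareBimodule_addEquiv Z K (RingEquiv.refl _) fun z i => rfl
  let E : P ≃+ (Fin m → TensorSquareBimodule Z) :=
    { toFun := fun x s => Θ.symm fun i j => e i j (peirceProj K P i j x) s
      invFun := fun y => (peirceEquiv K P).symm fun i j => (e i j).symm fun s => Θ (y s) i j
      left_inv := fun x => by
        rw [AddEquiv.symm_apply_eq]
        funext i j
        rw [LinearEquiv.symm_apply_eq]
        simp only [AddEquiv.apply_symm_apply]
        rfl
      right_inv := fun y => by
        funext s
        simp only [← peirceEquiv_apply, AddEquiv.apply_symm_apply, LinearEquiv.apply_symm_apply]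
        exact Θ.symm_apply_apply _
      map_add' := fun x y => by
        funext s
        simp only [map_add, Pi.add_apply]
        exact map_add Θ.symm (fun i j => e i j (peirceProj K P i j x) s)
          fun i j => e i j (peirceProj K P i j y) s }
  have hE : ∀ x s i j, Θ (E x s) i j = e i j (peirceProj K P i j x) s := fun x s i j =>
    congrFun (congrFun (Θ.apply_symm_apply fun i j => e i j (peirceProj K P i j x) s) i) j
  refine ⟨{ E with map_smul' := fun l x => ?_ }, fun l x => ?_⟩
  · funext s
    change E (l • x) s = l • E x s
    refine Θ.injective (funext fun i => funext fun j => ?_)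
    rw [hl, hE, hE, peirceProj_smul, ← tmul_one_smul hsmul, map_smul]
    rfl
  · funext s
    change E (op l • x) s = op l • E x s
    refine Θ.injective (funext fun i => funext fun j => ?_)
    rw [hr, hE, hE, peirceProj_op_smul, ← one_tmul_smul hsmul, map_smul]
    rfl

/-- Both sides are the dimension of `P e_j` over `K j` acting from the right: `K i ⊗[Z] K j`
contributes `[K i : Z]`. -/
theorem sum_finrank_column (hfree : ∀ i, Module.Free Z (K i)) (hfin : ∀ i, Module.Finite Z (K i))
    [Nontrivial Z] {g : ι → ι → ℕ}
    (E : ∀ i j, peirceComponent K P i j ≃ₗ[K i ⊗[Z] K j] (Fin (g i j) → K i ⊗[Z] K j)) {q : ℕ}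
    (e : P ≃+ ∀ i, Fin q → K i) (he : ∀ (l : ∀ i, K i) x i k, e (op l • x) i k = e x i k * l i) (j : ι) :
    ∑ i, g i j * Module.finrank Z (K i) = q := by
  -- Exchanging the tensor factors turns the right action of `K j` into the left scalar action on `K
  -- j ⊗[Z] K i`.
  let D : P ≃+ ∀ j i, Fin (g i j) → K j ⊗[Z] K i :=
    { toFun := fun x j i s => TensorProduct.comm Z _ _ (E i j (peirceProj K P i j x) s)
      invFun := fun y => (peirceEquiv K P).symm fun i j => (E i j).symm fun s =>
        (TensorProduct.comm Z _ _).symm (y j i s)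
      left_inv := fun x => by
        rw [AddEquiv.symm_apply_eq]
        funext i j
        rw [LinearEquiv.symm_apply_eq]
        simp only [LinearEquiv.symm_apply_apply]
        rfl
      right_inv := fun y => by
        funext j i s
        simp only [← peirceEquiv_apply, AddEquiv.apply_symm_apply, LinearEquiv.apply_symm_apply]
      map_add' := fun x y => by
        funext j i s
        simp only [map_add, Pi.add_apply] }
  have hcomm : ∀ (i j : ι) (b : K j) (u : K i ⊗[Z] K j),
      TensorProduct.comm Z _ _ (((1 : K i) ⊗ₜ[Z] b) • u) = b • TensorProduct.comm Z _ _ u := by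
    intro i j b u
    induction u using TensorProduct.induction_on with
    | zero => simp
    | tmul c c' => simp [TensorProduct.smul_tmul']
    | add u v hu hv => rw [smul_add, map_add, map_add, hu, hv, smul_add]
  have hD : ∀ (l : ∀ i, K i) x j, D (op l • x) j = l j • D x j := fun l x j => by
    funext i s
    change TensorProduct.comm Z _ _ (E i j (peirceProj K P i j (op l • x)) s) =
      l j • TensorProduct.comm Z _ _ (E i j (peirceProj K P i j x) s)
    rw [peirceProj_op_smul, ← one_tmul_smul hsmul, map_smul, Pi.smul_apply, hcomm]
  have f := piComponentLinearEquiv (D.symm.trans e) (fun (l : ∀ i, K i) y i => by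
    have h : D.symm (fun i => l i • y i) = op l • D.symm y := by
      rw [AddEquiv.symm_apply_eq]
      funext i
      rw [hD, AddEquiv.apply_symm_apply]
    funext k
    rw [AddEquiv.trans_apply, h, he, mul_comm]
    rfl) j
  have h1 := f.finrank_eq
  rw [Module.finrank_fin_fun, Module.finrank_pi_fintype] at h1
  rw [← h1]
  exact Finset.sum_congr rfl fun i _ => by
    rw [Module.finrank_pi_fintype]; simp

end Conclusion

/-! ### The Galois case and the main theorem. -/

section Main

attribute [local instance] coordAlgebra

variable {ι : Type u} [DecidableEq ι] {K : ι → Type v} [∀ i, Field (K i)]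
  {P : Type w} [AddCommGroup P] [Module (∀ i, K i) P] [Module (∀ i, K i)ᵐᵒᵖ P]
  [SMulCommClass (∀ i, K i) (∀ i, K i)ᵐᵒᵖ P] [Fintype ι]

/-- Functions with values in a product, with the arguments exchanged. -/
def piSwapAddEquiv (K : ι → Type v) [∀ i, Field (K i)] (d : ℕ) :
    (Fin d → ∀ i, K i) ≃+ ∀ i, Fin d → K i :=
  { Equiv.piComm fun (_ : Fin d) i => K i with map_add' := fun _ _ => rfl }

theorem sum_finrank_row [∀ i j, Module.Finite (K i) (peirceComponent K P i j)] {d : ℕ}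
    (e : P ≃ₗ[∀ i, K i] (Fin d → ∀ i, K i)) (i : ι) :
    ∑ j, Module.finrank (K i) (peirceComponent K P i j) = d := by
  have f := peirceRowEquiv (e.toAddEquiv.trans (piSwapAddEquiv K d)) (fun l x i => by
    funext k
    exact congrFun (congrFun (map_smul e l x) k) i) i
  have := f.finrank_eq
  rwa [Module.finrank_pi_fintype, Module.finrank_fin_fun] at this

/-- The row sums read `a i * ∑ n j * r j = d` with a second factor independent of `i`, nonzero
because `d ≥ 1`; so `a` is constant, and the column sums give the same for `r`. -/
theorem mul_const_of_sum_eq {n a r : ι → ℕ} {d : ℕ} (hd : 1 ≤ d)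
    (hrow : ∀ i, ∑ j, n j * (a i * r j) = d) (hcol : ∀ j, ∑ i, a i * r j * n i = d)
    (i j i' j' : ι) : a i * r j = a i' * r j' := by
  have h1 : ∀ i, a i * ∑ j, n j * r j = d := fun i => by
    rw [← hrow i, Finset.mul_sum]
    exact Finset.sum_congr rfl fun j _ => by ring
  have h2 : ∀ j, r j * ∑ i, a i * n i = d := fun j => by
    rw [← hcol j, Finset.mul_sum]
    exact Finset.sum_congr rfl fun j _ => by ring
  have e1 : a i = a i' := by
    refine Nat.eq_of_mul_eq_mul_right (Nat.pos_of_ne_zero fun h => ?_) ((h1 i).trans (h1 i').symm)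
    have := h1 i
    rw [h] at this
    omega
  have e2 : r j = r j' := by
    refine Nat.eq_of_mul_eq_mul_right (Nat.pos_of_ne_zero fun h => ?_) ((h2 j).trans (h2 j').symm)
    have := h2 j
    rw [h] at this
    omega
  rw [e1, e2]

theorem IsGaloisBimodule.exists_bimoduleIso [Nonempty ι]
    [∀ i j, Module.Finite (K i) (peirceComponent K P i j)] {d : ℕ}
    (hP : IsGaloisBimodule (∀ i, K i) P d) {Z : Subring (∀ i, K i)} [Nontrivial Z]
    [∀ i j, Module (K i ⊗[Z] K j) (peirceComponent K P i j)]
    (hsmul : ∀ i j (a : K i) (b : K j) (x : peirceComponent K P i j),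
      (a ⊗ₜ[Z] b) • x = a • peirceRightAction K P i j b x)
    (hfree : ∀ i, Module.Free Z (K i)) (hfin : ∀ i, Module.Finite Z (K i)) {a r : ι → ℕ}
    (ha : ∀ i, 0 < a i) (hr : ∀ j, 0 < r j)
    (e : ∀ i j, peirceComponent K P i j ≃ₗ[K i ⊗[Z] K j] (Fin (a i * r j) → K i ⊗[Z] K j))
    (hdim : ∀ i j, Module.finrank (K i) (peirceComponent K P i j) =
      Module.finrank Z (K j) * (a i * r j)) :
    ∃ m : ℕ, 0 < m ∧ BimoduleIso (∀ i, K i) P (Fin m → TensorSquareBimodule Z) := by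
  obtain ⟨hd, ⟨el⟩, ⟨er⟩, -⟩ := hP
  have hrow : ∀ i, ∑ j, Module.finrank Z (K j) * (a i * r j) = d := fun i => by
    rw [← sum_finrank_row el i]
    exact Finset.sum_congr rfl fun j _ => (hdim i j).symm
  have hcol := sum_finrank_column hsmul hfree hfin e (er.toAddEquiv.trans (piSwapAddEquiv K d))
    fun l x i k => congrFun (congrFun (map_smul er (op l) x) k) i
  have hconst := mul_const_of_sum_eq hd hrow hcol
  obtain ⟨i₀⟩ := ‹Nonempty ι›
  refine ⟨a i₀ * r i₀, Nat.mul_pos (ha i₀) (hr i₀), bimoduleIso_tensorSquareBimodule hsmul _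
    fun i j => (e i j).trans (LinearEquiv.funCongrLeft _ _ (finCongr (hconst i₀ i₀ i j)))⟩

theorem exists_bimoduleIso_of_isTensorPower [Nonempty ι]
    [∀ i j, Module.Finite (K i) (peirceComponent K P i j)]
    [∀ i j, Nontrivial (peirceComponent K P i j)] {Z : Subring (∀ i, K i)}
    (hZ : ∀ z, z ∈ Z ↔ ∀ i j (x : peirceComponent K P i j),
      z i • x = peirceRightAction K P i j (z j) x) {d : ℕ}
    {t : ∀ i j k, peirceComponent K P i j →+ peirceComponent K P j k →+
      (Fin d → peirceComponent K P i k)}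
    (ht : IsTensorPower (peirceRightAction K P) d t) :
    (∃ a r : ι → ℕ, (∀ i, 0 < a i) ∧ (∀ j, 0 < r j) ∧
      BimoduleIso (∀ i, K i) P (BlockBimodule Z a r)) ∧
    ((∃ d' : ℕ, IsGaloisBimodule (∀ i, K i) P d') →
      ∃ m : ℕ, 0 < m ∧ BimoduleIso (∀ i, K i) P (Fin m → TensorSquareBimodule Z)) := by
  have : Nontrivial Z := (isField_of_mem_iff hZ).nontrivial
  have hfree := free_of_mem_iff hZ
  have hfin := ht.coordHom_finite hZ
  let : ∀ i j, Module (K i ⊗[Z] K j) (peirceComponent K P i j) := fun i j =>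
    Module.compHom _ (tensorAction hZ i j)
  have hsmul : ∀ i j (a : K i) (b : K j) (x : peirceComponent K P i j),
      (a ⊗ₜ[Z] b) • x = a • peirceRightAction K P i j b x := fun i j => tensorAction_tmul hZ i j
  obtain ⟨g, hg, he, hdim, hmul⟩ := ht.exists_linearEquiv hZ hsmul
  obtain ⟨a, r, ha, hr, har⟩ := exists_eq_mul_of_mul_eq_mul hg hmul
  obtain rfl : g = fun i j => a i * r j := funext fun i => funext fun j => har i j
  have e := fun i j => (he i j).some
  exact ⟨⟨a, r, ha, hr, bimoduleIso_blockBimodule hsmul a r e⟩, fun ⟨d', hd'⟩ =>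
    hd'.exists_bimoduleIso hsmul hfree hfin ha hr e hdim⟩

end Main

theorem mainTheorem7 {ι : Type u} [Finite ι] [DecidableEq ι]
    (K : ι → Type v) [∀ i, Field (K i)]
    (P : Type w) [AddCommGroup P] [Module (∀ i, K i) P] [Module (∀ i, K i)ᵐᵒᵖ P]
    [SMulCommClass (∀ i, K i) (∀ i, K i)ᵐᵒᵖ P]
    (hconn : IsConnectedBimodule K P)
    (d : ℕ) (p q : ι → ℕ) (hp : ∀ i, 0 < p i) (hq : ∀ i, 0 < q i)
    (hP : IsQuasiGaloisBimodule K P d p q) :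
    IsField (bimoduleCenter (∀ i, K i) P) ∧
    (∀ i, Function.Injective (coordHom (bimoduleCenter (∀ i, K i) P) i) ∧
      (coordHom (bimoduleCenter (∀ i, K i) P) i).Finite) ∧
    (∃ a r : ι → ℕ, (∀ i, 0 < a i) ∧ (∀ j, 0 < r j) ∧
      BimoduleIso (∀ i, K i) P (BlockBimodule (bimoduleCenter (∀ i, K i) P) a r)) ∧
    ((∃ d' : ℕ, IsGaloisBimodule (∀ i, K i) P d') →
      ∃ m : ℕ, 0 < m ∧
        BimoduleIso (∀ i, K i) P
          (Fin m → TensorSquareBimodule (bimoduleCenter (∀ i, K i) P))) := by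
  have : Fintype ι := Fintype.ofFinite ι
  have : Nonempty ι := hconn.nonempty
  obtain ⟨⟨el, hel⟩, ⟨er, her⟩, e, he⟩ := hP
  have hfinP := finite_peirceComponent el hel
  have ht := isTensorPower_peirceMul e he
  have hnt := nontrivial_peirceComponent_of_connected hconn (nontrivial_of_row hp el hel)
    (nontrivial_of_column hq er her) ht.sum_finrank_mul_finrank
  have hZ := mem_bimoduleCenter_iff (K := K) (P := P)
  exact ⟨isField_of_mem_iff hZ,
    fun i => ⟨coordHom_injective_of_mem_iff hZ i, ht.coordHom_finite hZ i⟩,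
    exists_bimoduleIso_of_isTensorPower hZ ht⟩
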